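/- **Setting.** Let $D^{2,2,2}$ be the modular lattice with unity $I$ freely generated by three chains $x_i\subseteq y_i$ ($i=1,2,3$); sum and intersection are written $a+b$ and $ab$. Let $K$ be a field. A representation $\rho$ of $D^{2,2,2}$ in a finite-dimensional $K$-space $X$ is a lattice morphism from $D^{2,2,2}$ to the lattice of subspaces of $X$ with $\rho(I)=X$; it is indecomposable if $X\ne0$ and there is no decomposition $X=U\oplus V$ with $U,V\neq 0$ and $\rho(a)=\rho(a)U+\rho(a)V$ for all $a$. Linear equivalence is the lattice congruence $a\equiv b \bmod\theta$ iff $\rho(a)=\rho(b)$ for all indecomposable $\rho$. An inclusion $a\subseteq b \bmod \theta$ is an inclusion of the classes in the quotient lattice $D^{2,2,2}/\theta$, i.e. $a+b\equiv b\bmod\theta$. *Atomic elements* ($\{i,j,k\}=\{1,2,3\}$): $a_0^{ij}=A_0^{ij}=I$ and, for $n\ge1$, $a_n^{ij}=x_i+y_ja_{n-1}^{jk}$, $A_n^{ij}=y_i+x_jA_{n-1}^{ki}$. *Admissible elements.* A word $\alpha=i_n\dots i_1$ in the letters $1,2,3$ with distinct neighbours is an admissible sequence; words that differ by replacements $iji\to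 iki$ ($i,j,k$ distinct) are identified. With $q=k+3p$, $\gamma=(213)^{2p}(21)^{2k}$ ($k>0$, $p\ge0$) and $\beta=(213)^{2p}(21)^{2k+1}$ ($k,p\ge0$), put $$\begin{array}{lll} \alpha & f_\alpha & e_\alpha\\ \gamma & y_1y_2a^{13}_qA^{32}_{k-1} & y_2A^{32}_{k-1}a^{21}_qA^{13}_ka^{13}_q\\ 3\gamma & y_3(x_1+x_2)A^{23}_qa^{31}_{k-1} & y_3a^{31}_{k-1}A^{12}_{q+1}a^{12}_kA^{23}_q\\ 13\gamma & y_3y_1a^{32}_{q+1}A^{21}_{k-1} & y_1A^{21}_{k-1}a^{13}_{q+1}A^{32}_ka^{32}_{q+1}\\ (213)\gamma & y_2(x_3+x_1)A^{12}_{q+1}a^{23}_{k-1} & y_2a^{23}_{k-1}A^{31}_{q+2}a^{31}_kA^{12}_{q+1}\\ 3(213)\gamma & y_2y_3a^{21}_{q+2}A^{13}_{k-1} & y_3A^{13}_{k-1}a^{32}_{q+2}A^{21}_ka^{21}_{q+2}\\ 13(213)\gamma & y_1(x_2+x_3)A^{31}_{q+2}a^{12}_{k-1} & y_1a^{12}_{k-1}A^{23}_{q+3}a^{23}_kA^{31}_{q+2}\\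 1(21)^{2k}\ (k\ge0) & x_1A^{23}_ka^{23}_k & y_1A^{31}_ka^{12}_kA^{23}_ka^{23}_k\\ 1(21)^{2k+1}\ (k\ge0) & y_1(x_2+x_3)A^{31}_ka^{12}_k & y_1A^{31}_ka^{12}_kA^{23}_{k+1}a^{23}_{k+1}\\ \beta & y_2y_3a^{21}_qA^{13}_k & y_2A^{32}_ka^{21}_qA^{13}_ka^{13}_{q+1}\\ 3\beta & x_3A^{12}_{q+1}a^{12}_k & y_3a^{31}_kA^{12}_{q+1}a^{12}_kA^{23}_{q+1}\\ 13\beta & y_1y_2a^{13}_{q+1}A^{32}_k & y_1A^{21}_ka^{13}_{q+1}A^{32}_ka^{32}_{q+2}\\ (213)\beta & x_2A^{31}_{q+2}a^{31}_k & y_2a^{23}_kA^{31}_{q+2}a^{31}_kA^{12}_{q+2}\\ 3(213)\beta & y_3y_1a^{32}_{q+2}A^{21}_k & y_3A^{13}_ka^{32}_{q+2}A^{21}_ka^{21}_{q+3}\\ 13(213)\beta & x_1A^{23}_{q+3}a^{23}_k & y_1a^{12}_kA^{23}_{q+3}a^{23}_kA^{31}_{q+3} \end{array}$$ and take in addition all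 rows obtained from these by permuting the indices $1,2,3$; up to the identification these rows contain all admissible sequences. *Cumulative elements:* for $n\ge1$ and $t=1,2,3$, $x_t(n)=\sum f_{i_n\dots i_2t}$ and $y_t(n)=\sum e_{i_n\dots i_2t}$, summed over the admissible sequences of length $n$ that end in $t$. *Perfect elements* ($\{i,j,k\}=\{1,2,3\}$): $a_i(0)=y_j+y_k$, $b_i(0)=x_i+y_j+y_k$, $c_i(0)=y_1+y_2+y_3$, and for $n\ge1$: $a_i(n)=x_j(n)+x_k(n)+y_j(n+1)+y_k(n+1)$, $b_i(n)=a_i(n)+x_i(n+1)$, $c_i(n)=a_i(n)+y_i(n+1)$. They generate the lattice $H^+(n)$. Its lower cube is $$U_n=\{b_1b_2b_3,\ a_1b_2b_3,\ b_1a_2b_3,\ b_1b_2a_3,\ a_1a_2b_3,\ a_1b_2a_3,\ b_1a_2a_3,\ a_1a_2a_3\},\quad a_i=a_i(n),\ b_i=b_i(n),$$ and the upper cube of $H^+(n+1)$ is $$V_{n+1}=\{c_1,\ c_2,\ c_3,\ c_1c_2,\ c_2c_3,\ c_1c_3,\ c_1c_2c_3,\ c_1+c_2+c_3\},\quad c_i=c_i(n+1).$$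 **Proposition.** For every $n\ge0$ (and every field $K$), in the lattice $D^{2,2,2}/\theta$ each of $U_n$ and $V_{n+1}$ is an $8$-element Boolean algebra, and $U_n\cup V_{n+1}$ is a $16$-element Boolean algebra, with respect to the operations of $D^{2,2,2}/\theta$ (that is, the set of classes of its elements has the stated number of elements, is closed under sum and intersection, is distributive, and has a least element, a greatest element and complements). Moreover, the following $8$ inclusions hold modulo $\theta$: $$c_i(n+1)\subseteq a_i(n)b_j(n)b_k(n),\qquad c_i(n+1)c_j(n+1)\subseteq a_i(n)a_j(n)b_k(n)\qquad(\{i,j,k\}=\{1,2,3\}),$$ $$c_1(n+1)c_2(n+1)c_3(n+1)\subseteq a_1(n)a_2(n)a_3(n),\qquad c_1(n+1)+c_2(n+1)+c_3(n+1)\subseteq b_1(n)b_2(n)b_3(n).$$ -/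

import Mathlib

universe u

/-! ## The modular lattice `D^{2,2,2}` -/

/-- Lattice polynomials in the generators `x_i`, `y_i` (`i` in a three-element index set)
and the unity `I`. -/
inductive Poly222 : Type
  | unit : Poly222
  | x : Fin 3 → Poly222
  | y : Fin 3 → Poly222
  | add : Poly222 → Poly222 → Poly222
  | mul : Poly222 → Poly222 → Poly222

namespace Poly222

/-- The least preorder on lattice polynomials for which `add` is a supremum, `mul` is an infimum,
`unit` is a greatest element, `x_i ⊆ y_i`, and the modular law holds. -/
inductive Le : Poly222 → Poly222 → Prop
  | refl (a : Poly222) : Le a a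
  | trans {a b c : Poly222} : Le a b → Le b c → Le a c
  | le_unit (a : Poly222) : Le a unit
  | x_le_y (i : Fin 3) : Le (x i) (y i)
  | le_add_left (a b : Poly222) : Le a (add a b)
  | le_add_right (a b : Poly222) : Le b (add a b)
  | add_le {a b c : Poly222} : Le a c → Le b c → Le (add a b) c
  | mul_le_left (a b : Poly222) : Le (mul a b) a
  | mul_le_right (a b : Poly222) : Le (mul a b) b
  | le_mul {a b c : Poly222} : Le a b → Le a c → Le a (mul b c)
  | modular {a b : Poly222} (c : Poly222) : Le a b → Le (mul b (add a c)) (add a (mul b c))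

instance : Preorder Poly222 where
  le := Le
  le_refl := Le.refl
  le_trans _ _ _ := Le.trans

end Poly222

/-- The lattice `D^{2,2,2}`: the modular lattice with unity `I` (written `⊤`) freely generated by
three chains `x_i ⊆ y_i`. The sum is `⊔`, the intersection is `⊓`, the inclusion is `≤`. -/
def D222 : Type := Antisymmetrization Poly222 (· ≤ ·)

namespace D222

instance : PartialOrder D222 := inferInstanceAs (PartialOrder (Antisymmetrization Poly222 (· ≤ ·)))

/-- The element of `D^{2,2,2}` given by a lattice polynomial. -/
def ofPoly (a : Poly222) : D222 := toAntisymmetrization (· ≤ ·) a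

theorem ofPoly_le {a b : Poly222} : ofPoly a ≤ ofPoly b ↔ a ≤ b := Iff.rfl

theorem ofPoly_eq {a b : Poly222} (h : a ≤ b) (h' : b ≤ a) : ofPoly a = ofPoly b :=
  le_antisymm (ofPoly_le.2 h) (ofPoly_le.2 h')

theorem ofPoly_surj (a : D222) : ∃ p, ofPoly p = a := Quotient.exists_rep a

/-- The sum of two elements. -/
def add : D222 → D222 → D222 :=
  Quotient.map₂ Poly222.add fun _ _ h₁ _ _ h₂ =>
    ⟨.add_le (.trans h₁.1 (.le_add_left _ _)) (.trans h₂.1 (.le_add_right _ _)),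
      .add_le (.trans h₁.2 (.le_add_left _ _)) (.trans h₂.2 (.le_add_right _ _))⟩

/-- The intersection of two elements. -/
def mul : D222 → D222 → D222 :=
  Quotient.map₂ Poly222.mul fun _ _ h₁ _ _ h₂ =>
    ⟨.le_mul (.trans (.mul_le_left _ _) h₁.1) (.trans (.mul_le_right _ _) h₂.1),
      .le_mul (.trans (.mul_le_left _ _) h₁.2) (.trans (.mul_le_right _ _) h₂.2)⟩

instance : Lattice D222 where
  __ := (inferInstance : PartialOrder D222)
  sup := add
  inf := mul
  le_sup_left a b := by
    obtain ⟨a, rfl⟩ := ofPoly_surj a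
    obtain ⟨b, rfl⟩ := ofPoly_surj b
    exact Poly222.Le.le_add_left a b
  le_sup_right a b := by
    obtain ⟨a, rfl⟩ := ofPoly_surj a
    obtain ⟨b, rfl⟩ := ofPoly_surj b
    exact Poly222.Le.le_add_right a b
  sup_le a b c h h' := by
    obtain ⟨a, rfl⟩ := ofPoly_surj a
    obtain ⟨b, rfl⟩ := ofPoly_surj b
    obtain ⟨c, rfl⟩ := ofPoly_surj c
    exact Poly222.Le.add_le (ofPoly_le.1 h) (ofPoly_le.1 h')
  inf_le_left a b := by
    obtain ⟨a, rfl⟩ := ofPoly_surj a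
    obtain ⟨b, rfl⟩ := ofPoly_surj b
    exact Poly222.Le.mul_le_left a b
  inf_le_right a b := by
    obtain ⟨a, rfl⟩ := ofPoly_surj a
    obtain ⟨b, rfl⟩ := ofPoly_surj b
    exact Poly222.Le.mul_le_right a b
  le_inf a b c h h' := by
    obtain ⟨a, rfl⟩ := ofPoly_surj a
    obtain ⟨b, rfl⟩ := ofPoly_surj b
    obtain ⟨c, rfl⟩ := ofPoly_surj c
    exact Poly222.Le.le_mul (ofPoly_le.1 h) (ofPoly_le.1 h')

instance : OrderTop D222 where
  top := ofPoly .unit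
  le_top a := by
    obtain ⟨a, rfl⟩ := ofPoly_surj a
    exact Poly222.Le.le_unit a

/-- The generator `x_i`. -/
def x (i : Fin 3) : D222 := ofPoly (.x i)

/-- The generator `y_i`. -/
def y (i : Fin 3) : D222 := ofPoly (.y i)

theorem x_le_y (i : Fin 3) : x i ≤ y i := Poly222.Le.x_le_y i

instance : IsModularLattice D222 where
  sup_inf_le_assoc_of_le := by
    intro a b c h
    obtain ⟨a, rfl⟩ := ofPoly_surj a
    obtain ⟨b, rfl⟩ := ofPoly_surj b
    obtain ⟨c, rfl⟩ := ofPoly_surj c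
    rw [inf_comm, inf_comm (ofPoly b)]
    exact Poly222.Le.modular b (ofPoly_le.1 h)

/-! ## Atomic, admissible and cumulative elements -/

/-- The atomic element `a_n^{ij}`, where `k` is the third index:
`a_0^{ij} = I` and `a_n^{ij} = x_i + y_j a_{n-1}^{jk}`. -/
def aAtom : ℕ → Fin 3 → Fin 3 → Fin 3 → D222
  | 0, _, _, _ => ⊤
  | n + 1, i, j, k => x i ⊔ y j ⊓ aAtom n j k i

/-- The atomic element `A_n^{ij}`, where `k` is the third index:
`A_0^{ij} = I` and `A_n^{ij} = y_i + x_j A_{n-1}^{ki}`. -/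
def AAtom : ℕ → Fin 3 → Fin 3 → Fin 3 → D222
  | 0, _, _, _ => ⊤
  | n + 1, i, j, k => y i ⊔ x j ⊓ AAtom n k i j

/-- A row of the table of admissible elements: an admissible sequence `α`, written from left to
right, with the admissible elements `f_α` and `e_α`. -/
structure AdmRow where
  word : List (Fin 3)
  f : D222
  e : D222

/-- The word `w` repeated `m` times. -/
def wordPow (w : List (Fin 3)) (m : ℕ) : List (Fin 3) := (List.replicate m w).flatten

/-- The table of admissible sequences and admissible elements. The letters `1`, `2`, `3` of the
sequences `γ = (213)^{2p}(21)^{2k}`, `β = (213)^{2p}(21)^{2k+1}` and the indices `1`, `2`, `3` of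
the elements are replaced by `i₁`, `i₂`, `i₃`; throughout, `q = k + 3p`. The rows are numbered
`1, …, 14`; the rows `1, …, 6` are for `k > 0`, and the rows `7`, `8` do not depend on `p`. -/
def admRow (i₁ i₂ i₃ : Fin 3) (p k : ℕ) (line : ℕ) : AdmRow :=
  let q := k + 3 * p
  let γ := wordPow [i₂, i₁, i₃] (2 * p) ++ wordPow [i₂, i₁] (2 * k)
  let β := wordPow [i₂, i₁, i₃] (2 * p) ++ wordPow [i₂, i₁] (2 * k + 1)
  let x₁ := x i₁
  let x₂ := x i₂
  let x₃ := x i₃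
  let y₁ := y i₁
  let y₂ := y i₂
  let y₃ := y i₃
  let a12 := fun n => aAtom n i₁ i₂ i₃
  let a13 := fun n => aAtom n i₁ i₃ i₂
  let a21 := fun n => aAtom n i₂ i₁ i₃
  let a23 := fun n => aAtom n i₂ i₃ i₁
  let a31 := fun n => aAtom n i₃ i₁ i₂
  let a32 := fun n => aAtom n i₃ i₂ i₁
  let A12 := fun n => AAtom n i₁ i₂ i₃
  let A13 := fun n => AAtom n i₁ i₃ i₂
  let A21 := fun n => AAtom n i₂ i₁ i₃
  let A23 := fun n => AAtom n i₂ i₃ i₁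
  let A31 := fun n => AAtom n i₃ i₁ i₂
  let A32 := fun n => AAtom n i₃ i₂ i₁
  match line with
  | 1 => ⟨γ,
      y₁ ⊓ y₂ ⊓ a13 q ⊓ A32 (k - 1),
      y₂ ⊓ A32 (k - 1) ⊓ a21 q ⊓ A13 k ⊓ a13 q⟩
  | 2 => ⟨[i₃] ++ γ,
      y₃ ⊓ (x₁ ⊔ x₂) ⊓ A23 q ⊓ a31 (k - 1),
      y₃ ⊓ a31 (k - 1) ⊓ A12 (q + 1) ⊓ a12 k ⊓ A23 q⟩
  | 3 => ⟨[i₁, i₃] ++ γ,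
      y₃ ⊓ y₁ ⊓ a32 (q + 1) ⊓ A21 (k - 1),
      y₁ ⊓ A21 (k - 1) ⊓ a13 (q + 1) ⊓ A32 k ⊓ a32 (q + 1)⟩
  | 4 => ⟨[i₂, i₁, i₃] ++ γ,
      y₂ ⊓ (x₃ ⊔ x₁) ⊓ A12 (q + 1) ⊓ a23 (k - 1),
      y₂ ⊓ a23 (k - 1) ⊓ A31 (q + 2) ⊓ a31 k ⊓ A12 (q + 1)⟩
  | 5 => ⟨[i₃, i₂, i₁, i₃] ++ γ,
      y₂ ⊓ y₃ ⊓ a21 (q + 2) ⊓ A13 (k - 1),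
      y₃ ⊓ A13 (k - 1) ⊓ a32 (q + 2) ⊓ A21 k ⊓ a21 (q + 2)⟩
  | 6 => ⟨[i₁, i₃, i₂, i₁, i₃] ++ γ,
      y₁ ⊓ (x₂ ⊔ x₃) ⊓ A31 (q + 2) ⊓ a12 (k - 1),
      y₁ ⊓ a12 (k - 1) ⊓ A23 (q + 3) ⊓ a23 k ⊓ A31 (q + 2)⟩
  | 7 => ⟨[i₁] ++ wordPow [i₂, i₁] (2 * k),
      x₁ ⊓ A23 k ⊓ a23 k,
      y₁ ⊓ A31 k ⊓ a12 k ⊓ A23 k ⊓ a23 k⟩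
  | 8 => ⟨[i₁] ++ wordPow [i₂, i₁] (2 * k + 1),
      y₁ ⊓ (x₂ ⊔ x₃) ⊓ A31 k ⊓ a12 k,
      y₁ ⊓ A31 k ⊓ a12 k ⊓ A23 (k + 1) ⊓ a23 (k + 1)⟩
  | 9 => ⟨β,
      y₂ ⊓ y₃ ⊓ a21 q ⊓ A13 k,
      y₂ ⊓ A32 k ⊓ a21 q ⊓ A13 k ⊓ a13 (q + 1)⟩
  | 10 => ⟨[i₃] ++ β,
      x₃ ⊓ A12 (q + 1) ⊓ a12 k,
      y₃ ⊓ a31 k ⊓ A12 (q + 1) ⊓ a12 k ⊓ A23 (q + 1)⟩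
  | 11 => ⟨[i₁, i₃] ++ β,
      y₁ ⊓ y₂ ⊓ a13 (q + 1) ⊓ A32 k,
      y₁ ⊓ A21 k ⊓ a13 (q + 1) ⊓ A32 k ⊓ a32 (q + 2)⟩
  | 12 => ⟨[i₂, i₁, i₃] ++ β,
      x₂ ⊓ A31 (q + 2) ⊓ a31 k,
      y₂ ⊓ a23 k ⊓ A31 (q + 2) ⊓ a31 k ⊓ A12 (q + 2)⟩
  | 13 => ⟨[i₃, i₂, i₁, i₃] ++ β,
      y₃ ⊓ y₁ ⊓ a32 (q + 2) ⊓ A21 k,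
      y₃ ⊓ A13 k ⊓ a32 (q + 2) ⊓ A21 k ⊓ a21 (q + 3)⟩
  | _ => ⟨[i₁, i₃, i₂, i₁, i₃] ++ β,
      x₁ ⊓ A23 (q + 3) ⊓ a23 k,
      y₁ ⊓ a12 k ⊓ A23 (q + 3) ⊓ a23 k ⊓ A31 (q + 3)⟩

/-- The parameters of a row of the table: a permutation of the three indices (which yields the
sequences that start from any index, and the exchange of the two other indices), the exponent
parameters `p` and `k`, and the number of the row. -/
abbrev AdmIndex : Type := Equiv.Perm (Fin 3) × ℕ × ℕ × ℕ

/-- The row with the given parameters. -/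
def rowOf (s : AdmIndex) : AdmRow :=
  admRow (s.1 0) (s.1 1) (s.1 2) s.2.1 s.2.2.1 s.2.2.2

/-- The rows whose admissible sequence `i_n … i_2 t` has length `n` and ends in `t`. (In each of
the rows with a sequence of length `n` one may take `p, k ≤ n`, so that the bounds on `p` and `k`
are no restriction.) -/
def admIndices (t : Fin 3) (n : ℕ) : Finset AdmIndex :=
  (Finset.univ ×ˢ Finset.range (n + 1) ×ˢ Finset.range (n + 1) ×ˢ Finset.Icc 1 14).filter
    fun s => (s.2.2.2 ≤ 6 → 0 < s.2.2.1) ∧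
      (rowOf s).word.length = n ∧ (rowOf s).word.getLast? = some t

theorem wordPow_length (w : List (Fin 3)) (m : ℕ) : (wordPow w m).length = m * w.length := by
  simp [wordPow]

theorem wordPow_succ (w : List (Fin 3)) (m : ℕ) : wordPow w (m + 1) = wordPow w m ++ w := by
  simp [wordPow, List.replicate_succ']

theorem mem_admIndices {t : Fin 3} {n : ℕ} {σ : Equiv.Perm (Fin 3)} {p k line : ℕ} :
    (σ, p, k, line) ∈ admIndices t n ↔ (p < n + 1 ∧ k < n + 1 ∧ 1 ≤ line ∧ line ≤ 14) ∧
      (line ≤ 6 → 0 < k) ∧ (admRow (σ 0) (σ 1) (σ 2) p k line).word.length = n ∧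
        (admRow (σ 0) (σ 1) (σ 2) p k line).word.getLast? = some t := by
  unfold admIndices
  rw [Finset.mem_filter]
  simp only [rowOf, Finset.mem_product, Finset.mem_univ, Finset.mem_range, Finset.mem_Icc,
    true_and]

/-- There is an admissible sequence of each positive length ending in `t`. -/
theorem admIndices_nonempty (t : Fin 3) {n : ℕ} (hn : 0 < n) : (admIndices t n).Nonempty := by
  obtain ⟨m, hm | hm | hm | hm⟩ : ∃ m, n = 4 * m + 1 ∨ n = 4 * m + 3 ∨ n = 4 * m + 2 ∨
      n = 4 * (m + 1) := ⟨(n - 1) / 4, by omega⟩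
  · refine ⟨(Equiv.swap 0 t, 0, m, 7), mem_admIndices.2 ?_⟩
    refine ⟨by omega, by omega, by simp [admRow, wordPow_length]; omega, ?_⟩
    simp only [admRow]
    rcases m with _ | m
    · simp [wordPow]
    · rw [show 2 * (m + 1) = 2 * m + 1 + 1 by ring, wordPow_succ, ← List.append_assoc,
        List.getLast?_append]
      simp
  · refine ⟨(Equiv.swap 0 t, 0, m, 8), mem_admIndices.2 ?_⟩
    refine ⟨by omega, by omega, by simp [admRow, wordPow_length]; omega, ?_⟩
    simp only [admRow]
    rw [wordPow_succ, ← List.append_assoc, List.getLast?_append]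
    simp
  · refine ⟨(Equiv.swap 0 t, 0, m, 9), mem_admIndices.2 ?_⟩
    refine ⟨by omega, by omega, by simp [admRow, wordPow_length]; omega, ?_⟩
    simp only [admRow]
    rw [wordPow_succ]
    simp
  · refine ⟨(Equiv.swap 0 t, 0, m + 1, 1), mem_admIndices.2 ?_⟩
    refine ⟨by omega, by omega, by simp [admRow, wordPow_length]; omega, ?_⟩
    simp only [admRow]
    rw [show 2 * (m + 1) = 2 * m + 1 + 1 by ring, wordPow_succ]
    simp

/-- The cumulative element `x_t(n) = ∑ f_{i_n … i_2 t}`, `n ≥ 1` (the value at `n = 0` is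
irrelevant). -/
def xCum (t : Fin 3) (n : ℕ) : D222 :=
  if hn : 0 < n then (admIndices t n).sup' (admIndices_nonempty t hn) fun s => (rowOf s).f else ⊤

/-- The cumulative element `y_t(n) = ∑ e_{i_n … i_2 t}`, `n ≥ 1` (the value at `n = 0` is
irrelevant). -/
def yCum (t : Fin 3) (n : ℕ) : D222 :=
  if hn : 0 < n then (admIndices t n).sup' (admIndices_nonempty t hn) fun s => (rowOf s).e else ⊤

/-! ## The generators `a_i(n) ⊆ b_i(n) ⊆ c_i(n)` of `H^+(n)` and the two cubes

For an index `i`, the two other indices are `i + 1` and `i + 2` (modulo three). -/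

/-- `a_i(0) = y_j + y_k`, and `a_i(n) = x_j(n) + x_k(n) + y_j(n+1) + y_k(n+1)` for `n ≥ 1`. -/
def aGen (i : Fin 3) : ℕ → D222
  | 0 => y (i + 1) ⊔ y (i + 2)
  | n + 1 => xCum (i + 1) (n + 1) ⊔ xCum (i + 2) (n + 1) ⊔
      yCum (i + 1) (n + 2) ⊔ yCum (i + 2) (n + 2)

/-- `b_i(0) = x_i + y_j + y_k`, and `b_i(n) = a_i(n) + x_i(n+1)` for `n ≥ 1`. -/
def bGen (i : Fin 3) : ℕ → D222
  | 0 => x i ⊔ y (i + 1) ⊔ y (i + 2)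
  | n + 1 => aGen i (n + 1) ⊔ xCum i (n + 2)

/-- `c_i(0) = y_1 + y_2 + y_3`, and `c_i(n) = a_i(n) + y_i(n+1)` for `n ≥ 1`. -/
def cGen (i : Fin 3) : ℕ → D222
  | 0 => y 0 ⊔ y 1 ⊔ y 2
  | n + 1 => aGen i (n + 1) ⊔ yCum i (n + 2)

/-- The lower cube `U_n` of `H^+(n)`. -/
def lowerCube (n : ℕ) : Set D222 :=
  let a := fun i => aGen i n
  let b := fun i => bGen i n
  {b 0 ⊓ b 1 ⊓ b 2, a 0 ⊓ b 1 ⊓ b 2, b 0 ⊓ a 1 ⊓ b 2, b 0 ⊓ b 1 ⊓ a 2,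
    a 0 ⊓ a 1 ⊓ b 2, a 0 ⊓ b 1 ⊓ a 2, b 0 ⊓ a 1 ⊓ a 2, a 0 ⊓ a 1 ⊓ a 2}

/-- The upper cube `V_n` of `H^+(n)` (`n ≥ 1`). -/
def upperCube (n : ℕ) : Set D222 :=
  let c := fun i => cGen i n
  {c 0, c 1, c 2, c 0 ⊓ c 1, c 1 ⊓ c 2, c 0 ⊓ c 2, c 0 ⊓ c 1 ⊓ c 2, c 0 ⊔ c 1 ⊔ c 2}

/-! ## Linear representations and linear equivalence -/

/-- A linear representation of `D^{2,2,2}` in the vector space `X`: a morphism of lattices with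
unity into the lattice of subspaces of `X`. -/
structure LinRep (K : Type u) [Field K] (X : Type u) [AddCommGroup X] [Module K X] extends
    LatticeHom D222 (Submodule K X) where
  map_top' : toFun ⊤ = ⊤

/-- A representation in `X` is indecomposable if `X ≠ 0` and there is no direct decomposition
`X = U ⊕ V` with `U, V ≠ 0` and `ρ(a) = ρ(a)U + ρ(a)V` for all `a`. -/
def LinRep.Indecomposable {K : Type u} [Field K] {X : Type u} [AddCommGroup X] [Module K X]
    (ρ : LinRep K X) : Prop :=
  Nontrivial X ∧ ∀ U V : Submodule K X, IsCompl U V →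
    (∀ a : D222, ρ.toLatticeHom a = ρ.toLatticeHom a ⊓ U ⊔ ρ.toLatticeHom a ⊓ V) →
    U = ⊥ ∨ V = ⊥

/-- The linear equivalence `θ`: `a ≡ b mod θ` if `ρ(a) = ρ(b)` for all indecomposable
representations `ρ` in finite-dimensional vector spaces over `K`. -/
def theta (K : Type u) [Field K] : LatticeCon D222 where
  r a b := ∀ (X : Type u) [AddCommGroup X] [Module K X] [FiniteDimensional K X] (ρ : LinRep K X),
    ρ.Indecomposable → ρ.toLatticeHom a = ρ.toLatticeHom b
  iseqv :=
    { refl := fun _ _ _ _ _ _ _ => rfl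
      symm := fun h X _ _ _ ρ hρ => (h X ρ hρ).symm
      trans := fun h h' X _ _ _ ρ hρ => (h X ρ hρ).trans (h' X ρ hρ) }
  inf h h' X _ _ _ ρ hρ := by rw [map_inf, map_inf, h X ρ hρ, h' X ρ hρ]
  sup h h' X _ _ _ ρ hρ := by rw [map_sup, map_sup, h X ρ hρ, h' X ρ hρ]

end D222

/-- The quotient lattice `D^{2,2,2}/θ`. -/
def D222ModTheta (K : Type u) [Field K] : Type := Quotient (D222.theta K).toSetoid

namespace D222ModTheta

/-- The class of an element of `D^{2,2,2}` modulo `θ`. -/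
def mk (K : Type u) [Field K] (a : D222) : D222ModTheta K :=
  Quotient.mk (D222.theta K).toSetoid a

theorem mk_surj {K : Type u} [Field K] (a : D222ModTheta K) : ∃ b, mk K b = a :=
  Quotient.exists_rep a

instance (K : Type u) [Field K] : Max (D222ModTheta K) :=
  ⟨Quotient.map₂ (· ⊔ ·) fun _ _ h _ _ h' => (D222.theta K).sup h h'⟩

instance (K : Type u) [Field K] : Min (D222ModTheta K) :=
  ⟨Quotient.map₂ (· ⊓ ·) fun _ _ h _ _ h' => (D222.theta K).inf h h'⟩

theorem mk_sup {K : Type u} [Field K] (a b : D222) : mk K a ⊔ mk K b = mk K (a ⊔ b) := rfl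

theorem mk_inf {K : Type u} [Field K] (a b : D222) : mk K a ⊓ mk K b = mk K (a ⊓ b) := rfl

/-- The lattice operations are those induced from `D^{2,2,2}`; the inclusion is
`a ≤ b ↔ a ⊔ b = b`. -/
instance (K : Type u) [Field K] : Lattice (D222ModTheta K) :=
  Lattice.mk'
    (fun a b => by
      obtain ⟨a, rfl⟩ := mk_surj a
      obtain ⟨b, rfl⟩ := mk_surj b
      rw [mk_sup, mk_sup, sup_comm])
    (fun a b c => by
      obtain ⟨a, rfl⟩ := mk_surj a
      obtain ⟨b, rfl⟩ := mk_surj b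
      obtain ⟨c, rfl⟩ := mk_surj c
      rw [mk_sup, mk_sup, mk_sup, mk_sup, sup_assoc])
    (fun a b => by
      obtain ⟨a, rfl⟩ := mk_surj a
      obtain ⟨b, rfl⟩ := mk_surj b
      rw [mk_inf, mk_inf, inf_comm])
    (fun a b c => by
      obtain ⟨a, rfl⟩ := mk_surj a
      obtain ⟨b, rfl⟩ := mk_surj b
      obtain ⟨c, rfl⟩ := mk_surj c
      rw [mk_inf, mk_inf, mk_inf, mk_inf, inf_assoc])
    (fun a b => by
      obtain ⟨a, rfl⟩ := mk_surj a
      obtain ⟨b, rfl⟩ := mk_surj b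
      rw [mk_inf, mk_sup, sup_inf_self])
    (fun a b => by
      obtain ⟨a, rfl⟩ := mk_surj a
      obtain ⟨b, rfl⟩ := mk_surj b
      rw [mk_sup, mk_inf, inf_sup_self])

end D222ModTheta

/-- A subset `S` of a lattice is a Boolean algebra (with respect to the operations of the lattice):
it is closed under `⊔` and `⊓`, it is distributive, it has a least element `o` and a greatest
element `e`, and each of its elements has a complement in it. -/
structure IsBooleanSublattice {L : Type*} [Lattice L] (S : Set L) : Prop where
  supClosed : SupClosed S
  infClosed : InfClosed S
  distrib : ∀ a ∈ S, ∀ b ∈ S, ∀ c ∈ S, a ⊓ (b ⊔ c) = a ⊓ b ⊔ a ⊓ c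
  complemented : ∃ o ∈ S, ∃ e ∈ S, (∀ z ∈ S, o ≤ z ∧ z ≤ e) ∧
    ∀ z ∈ S, ∃ z' ∈ S, z ⊓ z' = o ∧ z ⊔ z' = e

/-! ## Representations given by three chains of subspaces -/

/-! The sixteen elements are compared by their values in indecomposable representations. In each of
these every element of the two cubes is `⊥` or `⊤`, and only six patterns of values occur: all zero,
all full, and four patterns that read off the four coordinates of `Bool × Bool × Bool × Bool`
(`HasType`, `HasType.apply_cubeElt`). So `cubeElt n` followed by the quotient map is a lattice
homomorphism from the sixteen-element Boolean algebra. It is injective because each coordinate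
pattern is realized in finite dimension (`exists_hasType`). The two cubes are the images of opposite
facets, and the inclusions hold pattern by pattern.

The values are found with the Coxeter functor Φ⁺. Its space consists of the triples (η_i) with η_i ∈
Y_i and sum zero, and it has projections φ_i to X. The main fact is that the φ-images of x_t(n),
y_t(n) computed in Φ⁺ρ add up to x_t(n+1), y_t(n+1) in ρ (`push_xCum`, `push_yCum`). To see this,
describe a word by its last letter and the numbers u, v of its forward and backward steps around the
cycle of indices; `eForm` and `fForm` write the whole table in these terms. Atomic elements of Φ⁺ρ
are preimages of atomic elements of ρ (`cox_AAtom_aAtom`), and the modular law then shows that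
applying a projection adds one step to the word (`IsStepFamily`).

If some two Y_i do not span X, an indecomposable ρ is a line with these two Y_i zero, and its
pattern is computed directly. Otherwise Φ⁺ρ is again indecomposable, and its pattern at level n is
the pattern of ρ at level n+1. Induction on n gives the classification
(`LinRep.Indecomposable.hasType`).

Conversely, an indecomposable of negative defect has pairwise disjoint X_i, hence is isomorphic to
Φ⁺Φ⁻ρ. The defect is preserved, so examples at level 0 can be lifted to every level. -/

namespace Poly222

/-- The value of a lattice polynomial at two families of elements of a lattice with unity. -/
def eval {L : Type*} [Lattice L] [OrderTop L] (x y : Fin 3 → L) : Poly222 → L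
  | .unit => ⊤
  | .x i => x i
  | .y i => y i
  | .add a b => eval x y a ⊔ eval x y b
  | .mul a b => eval x y a ⊓ eval x y b

theorem eval_mono {L : Type*} [Lattice L] [OrderTop L] [IsModularLattice L] {x y : Fin 3 → L}
    (h : ∀ i, x i ≤ y i) {a b : Poly222} (hab : Le a b) : eval x y a ≤ eval x y b := by
  induction hab with
  | refl a => exact le_rfl
  | trans _ _ h₁ h₂ => exact h₁.trans h₂
  | le_unit a => exact le_top
  | x_le_y i => exact h i
  | le_add_left a b => exact le_sup_left
  | le_add_right a b => exact le_sup_right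
  | add_le _ _ h₁ h₂ => exact sup_le h₁ h₂
  | mul_le_left a b => exact inf_le_left
  | mul_le_right a b => exact inf_le_right
  | le_mul _ _ h₁ h₂ => exact le_inf h₁ h₂
  | modular c _ h₁ =>
    simp only [eval]
    rw [inf_comm, inf_comm (eval x y _) (eval x y c)]
    exact IsModularLattice.sup_inf_le_assoc_of_le _ h₁

end Poly222

namespace D222

/-- Induction over the elements of `D^{2,2,2}`. -/
theorem induction {p : D222 → Prop} (top : p ⊤) (gen_x : ∀ i, p (x i)) (gen_y : ∀ i, p (y i))
    (sup : ∀ a b, p a → p b → p (a ⊔ b)) (inf : ∀ a b, p a → p b → p (a ⊓ b)) (a : D222) :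
    p a := by
  obtain ⟨a, rfl⟩ := ofPoly_surj a
  induction a with
  | unit => exact top
  | x i => exact gen_x i
  | y i => exact gen_y i
  | add a b ha hb => exact sup _ _ ha hb
  | mul a b ha hb => exact inf _ _ ha hb

namespace LinRep

variable {K : Type u} [Field K] {X : Type u} [AddCommGroup X] [Module K X]

instance : CoeFun (LinRep K X) fun _ => D222 → Submodule K X := ⟨fun ρ => ρ.toLatticeHom⟩

@[simp] theorem apply_top (ρ : LinRep K X) : ρ ⊤ = ⊤ := ρ.map_top'

theorem mono (ρ : LinRep K X) {a b : D222} (h : a ≤ b) : ρ a ≤ ρ b :=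
  OrderHomClass.mono ρ.toLatticeHom h

theorem x_le_y (ρ : LinRep K X) (i : Fin 3) : ρ (x i) ≤ ρ (y i) := ρ.mono (D222.x_le_y i)

/-- The representation given by three chains of subspaces. -/
def ofChains (P Q : Fin 3 → Submodule K X) (h : ∀ i, P i ≤ Q i) : LinRep K X where
  toFun := Quotient.lift (Poly222.eval P Q) fun _ _ hab =>
    le_antisymm (Poly222.eval_mono h hab.1) (Poly222.eval_mono h hab.2)
  map_sup' a b := by
    obtain ⟨a, rfl⟩ := ofPoly_surj a
    obtain ⟨b, rfl⟩ := ofPoly_surj b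
    rfl
  map_inf' a b := by
    obtain ⟨a, rfl⟩ := ofPoly_surj a
    obtain ⟨b, rfl⟩ := ofPoly_surj b
    rfl
  map_top' := rfl

@[simp] theorem ofChains_x (P Q : Fin 3 → Submodule K X) (h : ∀ i, P i ≤ Q i) (i : Fin 3) :
    ofChains P Q h (x i) = P i := rfl

@[simp] theorem ofChains_y (P Q : Fin 3 → Submodule K X) (h : ∀ i, P i ≤ Q i) (i : Fin 3) :
    ofChains P Q h (y i) = Q i := rfl

/-- A linear equivalence that matches the generating subspaces matches all subspaces. -/
theorem map_equiv {X' : Type u} [AddCommGroup X'] [Module K X'] (ρ : LinRep K X)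
    (ρ' : LinRep K X') (f : X ≃ₗ[K] X')
    (hx : ∀ i, (ρ (x i)).map (f : X →ₗ[K] X') = ρ' (x i))
    (hy : ∀ i, (ρ (y i)).map (f : X →ₗ[K] X') = ρ' (y i)) (a : D222) :
    (ρ a).map (f : X →ₗ[K] X') = ρ' a := by
  induction a using D222.induction with
  | top => simp [LinearMap.range_eq_top.2 f.surjective]
  | gen_x i => exact hx i
  | gen_y i => exact hy i
  | sup a b ha hb => rw [map_sup, map_sup, Submodule.map_sup, ha, hb]
  | inf a b ha hb =>
    rw [map_inf, map_inf, Submodule.map_inf (f : X →ₗ[K] X') f.injective, ha, hb]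

/-! ### Direct decompositions -/

/-- The subspace `W` is compatible with the decomposition into `U` and `V`. -/
def Splits (U V W : Submodule K X) : Prop :=
  ∀ u ∈ U, ∀ v ∈ V, u + v ∈ W → u ∈ W ∧ v ∈ W

theorem Splits.eq_sup {U V W : Submodule K X} (hUV : IsCompl U V) (h : Splits U V W) :
    W = W ⊓ U ⊔ W ⊓ V := by
  refine le_antisymm (fun w hw => ?_) (sup_le inf_le_left inf_le_left)
  obtain ⟨u, hu, v, hv, rfl⟩ := Submodule.mem_sup.1 (hUV.sup_eq_top ▸ Submodule.mem_top : w ∈ U ⊔ V)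
  obtain ⟨h₁, h₂⟩ := h u hu v hv hw
  exact Submodule.add_mem_sup ⟨h₁, hu⟩ ⟨h₂, hv⟩

theorem eq_of_add_eq_add {U V : Submodule K X} (hUV : Disjoint U V) {u u' v v' : X} (hu : u ∈ U)
    (hu' : u' ∈ U) (hv : v ∈ V) (hv' : v' ∈ V) (h : u + v = u' + v') : u = u' ∧ v = v' := by
  have h₀ : u - u' = v' - v := by
    rw [sub_eq_sub_iff_add_eq_add, h, add_comm]
  have h₁ : u - u' = 0 :=
    Submodule.disjoint_def.1 hUV _ (sub_mem hu hu') (h₀ ▸ sub_mem hv' hv)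
  exact ⟨sub_eq_zero.1 h₁, (sub_eq_zero.1 (h₀ ▸ h₁)).symm⟩

theorem splits_of_le_sup {U V W : Submodule K X} (hUV : IsCompl U V)
    (h : W ≤ W ⊓ U ⊔ W ⊓ V) : Splits U V W := by
  intro u hu v hv hw
  obtain ⟨u', hu', v', hv', he⟩ := Submodule.mem_sup.1 (h hw)
  obtain ⟨rfl, rfl⟩ := eq_of_add_eq_add hUV.disjoint hu'.2 hu hv'.2 hv he
  exact ⟨hu'.1, hv'.1⟩

/-- Compatibility with a decomposition passes to sums and intersections, so only the six generating
subspaces have to be tested. -/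
theorem splits_apply (ρ : LinRep K X) {U V : Submodule K X} (hUV : IsCompl U V)
    (hx : ∀ i, Splits U V (ρ (x i))) (hy : ∀ i, Splits U V (ρ (y i))) (a : D222) :
    Splits U V (ρ a) := by
  induction a using D222.induction with
  | top => intro u _ v _ _; simp
  | gen_x i => exact hx i
  | gen_y i => exact hy i
  | sup a b ha hb =>
    refine splits_of_le_sup hUV ?_
    rw [map_sup]
    refine sup_le ((ha.eq_sup hUV).le.trans ?_) ((hb.eq_sup hUV).le.trans ?_)
    · exact sup_le_sup (inf_le_inf_right _ le_sup_left) (inf_le_inf_right _ le_sup_left)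
    · exact sup_le_sup (inf_le_inf_right _ le_sup_right) (inf_le_inf_right _ le_sup_right)
  | inf a b ha hb =>
    intro u hu v hv h
    rw [map_inf] at h ⊢
    exact ⟨⟨(ha u hu v hv h.1).1, (hb u hu v hv h.2).1⟩, (ha u hu v hv h.1).2,
      (hb u hu v hv h.2).2⟩

theorem Indecomposable.eq_bot_or {ρ : LinRep K X} (hρ : ρ.Indecomposable) {U V : Submodule K X}
    (hUV : IsCompl U V) (hx : ∀ i, Splits U V (ρ (x i))) (hy : ∀ i, Splits U V (ρ (y i))) :
    U = ⊥ ∨ V = ⊥ :=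
  hρ.2 U V hUV fun a => (ρ.splits_apply hUV hx hy a).eq_sup hUV

theorem indecomposable_of_splits {ρ : LinRep K X} [Nontrivial X]
    (h : ∀ U V : Submodule K X, IsCompl U V → (∀ i, Splits U V (ρ (x i))) →
      (∀ i, Splits U V (ρ (y i))) → U = ⊥ ∨ V = ⊥) : ρ.Indecomposable :=
  ⟨‹_›, fun U V hUV hs => h U V hUV (fun i => splits_of_le_sup hUV (hs (x i)).le)
    fun i => splits_of_le_sup hUV (hs (y i)).le⟩

/-! ### The Coxeter functor -/

/-- The space of the representation `Φ⁺ρ`. -/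
def coxSpace (ρ : LinRep K X) : Submodule K (Fin 3 → X) where
  carrier := {η | (∀ i, η i ∈ ρ (y i)) ∧ η 0 + η 1 + η 2 = 0}
  add_mem' {η ζ} h h' := ⟨fun i => add_mem (h.1 i) (h'.1 i), by
    have : (η + ζ) 0 + (η + ζ) 1 + (η + ζ) 2 = (η 0 + η 1 + η 2) + (ζ 0 + ζ 1 + ζ 2) := by
      simp only [Pi.add_apply]; abel
    rw [this, h.2, h'.2, add_zero]⟩
  zero_mem' := ⟨fun i => zero_mem _, by simp⟩
  smul_mem' c η h := ⟨fun i => Submodule.smul_mem _ c (h.1 i), by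
    simp only [Pi.smul_apply, ← smul_add, h.2, smul_zero]⟩

/-- The projection `φ_i` of the space of `Φ⁺ρ` to the space of `ρ`. -/
def proj (ρ : LinRep K X) (i : Fin 3) : coxSpace ρ →ₗ[K] X :=
  LinearMap.proj i ∘ₗ (coxSpace ρ).subtype

/-- The representation `Φ⁺ρ`. -/
def cox (ρ : LinRep K X) : LinRep K (coxSpace ρ) :=
  ofChains (fun i => (⊥ : Submodule K X).comap (ρ.proj i)) (fun i => (ρ (x i)).comap (ρ.proj i))
    fun _ => Submodule.comap_mono bot_le

theorem cox_x (ρ : LinRep K X) (i : Fin 3) :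
    ρ.cox (x i) = (⊥ : Submodule K X).comap (ρ.proj i) := rfl

theorem cox_y (ρ : LinRep K X) (i : Fin 3) : ρ.cox (y i) = (ρ (x i)).comap (ρ.proj i) := rfl

theorem proj_mem (ρ : LinRep K X) (i : Fin 3) (η : coxSpace ρ) : ρ.proj i η ∈ ρ (y i) := η.2.1 i

end LinRep

/-- The indices `i`, `j`, `k` are distinct. -/
structure Distinct (i j k : Fin 3) : Prop where
  ij : i ≠ j
  jk : j ≠ k
  ik : i ≠ k

namespace Distinct

variable {i j k : Fin 3}

theorem rot (h : Distinct i j k) : Distinct j k i := ⟨h.jk, h.ik.symm, h.ij.symm⟩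

theorem swap (h : Distinct i j k) : Distinct i k j := ⟨h.ik, h.jk.symm, h.ij⟩

theorem sum_eq {M : Type*} [AddCommGroup M] (h : Distinct i j k) (η : Fin 3 → M) :
    η i + η j + η k = η 0 + η 1 + η 2 := by
  obtain ⟨h₁, h₂, h₃⟩ := h
  fin_cases i <;> fin_cases j <;> fin_cases k <;> first | exact absurd rfl ‹_› | (simp; try abel)

theorem forall_iff (h : Distinct i j k) {p : Fin 3 → Prop} : (∀ s, p s) ↔ p i ∧ p j ∧ p k := by
  refine ⟨fun H => ⟨H _, H _, H _⟩, fun H s => ?_⟩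
  have : s = i ∨ s = j ∨ s = k := by
    obtain ⟨h₁, h₂, h₃⟩ := h
    clear H
    revert i j k s
    decide
  rcases this with rfl | rfl | rfl
  exacts [H.1, H.2.1, H.2.2]

end Distinct

/-! ### Images and preimages under the projections φ_i -/

namespace LinRep

variable {K : Type u} [Field K] {X : Type u} [AddCommGroup X] [Module K X]
variable (ρ : LinRep K X) {i j k : Fin 3}

theorem proj_sum (h : Distinct i j k) (η : coxSpace ρ) :
    ρ.proj i η + ρ.proj j η + ρ.proj k η = 0 :=
  (h.sum_eq η.1).trans η.2.2

theorem exists_proj (h : Distinct i j k) {a b c : X} (ha : a ∈ ρ (y i)) (hb : b ∈ ρ (y j))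
    (hc : c ∈ ρ (y k)) (h0 : a + b + c = 0) :
    ∃ η : coxSpace ρ, ρ.proj i η = a ∧ ρ.proj j η = b ∧ ρ.proj k η = c := by
  set η : Fin 3 → X := fun s => if s = i then a else if s = j then b else c with hη
  have hi : η i = a := by simp [hη]
  have hj : η j = b := by simp [hη, h.ij.symm]
  have hk : η k = c := by simp [hη, h.ik.symm, h.jk.symm]
  refine ⟨⟨η, h.forall_iff.2 ⟨hi ▸ ha, hj ▸ hb, hk ▸ hc⟩, ?_⟩, hi, hj, hk⟩
  rw [← h.sum_eq, hi, hj, hk, h0]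

theorem coxSpace_ext (h : Distinct i j k) {η ζ : coxSpace ρ} (h₁ : ρ.proj i η = ρ.proj i ζ)
    (h₂ : ρ.proj j η = ρ.proj j ζ) : η = ζ := by
  have h₃ : ρ.proj k η = ρ.proj k ζ := by
    have e := ρ.proj_sum h η
    rw [← ρ.proj_sum h ζ, h₁, h₂] at e
    exact add_left_cancel e
  exact Subtype.ext (funext (h.forall_iff.2 ⟨h₁, h₂, h₃⟩))

/-- The image of an intersection of preimages under the three projections. -/
theorem map_proj_box (h : Distinct i j k) (P Q R : Submodule K X) :
    (P.comap (ρ.proj i) ⊓ Q.comap (ρ.proj j) ⊓ R.comap (ρ.proj k)).map (ρ.proj k) =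
      (ρ (y k) ⊓ R) ⊓ (ρ (y i) ⊓ P ⊔ ρ (y j) ⊓ Q) := by
  ext w
  constructor
  · rintro ⟨η, ⟨⟨hP, hQ⟩, hR⟩, rfl⟩
    refine ⟨⟨ρ.proj_mem k η, hR⟩, ?_⟩
    have e : ρ.proj k η = -(ρ.proj i η + ρ.proj j η) := by
      rw [eq_neg_iff_add_eq_zero, add_comm]; exact ρ.proj_sum h η
    rw [e]
    exact neg_mem (Submodule.add_mem_sup ⟨ρ.proj_mem i η, hP⟩ ⟨ρ.proj_mem j η, hQ⟩)
  · rintro ⟨⟨hy, hR⟩, hw⟩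
    obtain ⟨a, ⟨ha, haP⟩, b, ⟨hb, hbQ⟩, rfl⟩ := Submodule.mem_sup.1 hw
    obtain ⟨η, h₁, h₂, h₃⟩ := ρ.exists_proj h (neg_mem ha) (neg_mem hb) hy (by abel)
    refine ⟨η, ⟨⟨?_, ?_⟩, ?_⟩, h₃⟩
    · show ρ.proj i η ∈ P
      rw [h₁]; exact neg_mem haP
    · show ρ.proj j η ∈ Q
      rw [h₂]; exact neg_mem hbQ
    · show ρ.proj k η ∈ R
      rw [h₃]; exact hR

/-- The relation φ_i + φ_j + φ_k = 0 turns the recursion of one kind of atomic element in Φ⁺ρ into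
the recursion of the other kind in ρ. On ker φ_j one has φ_i = -φ_k, which handles `AAtom`; for
`aAtom`, φ_i is replaced by -(φ_j + φ_k). -/
theorem cox_AAtom_aAtom (n : ℕ) : ∀ {i j k : Fin 3}, Distinct i j k →
    ρ.cox (AAtom n i j k) = (ρ (aAtom n i k j)).comap (ρ.proj i) ∧
      ρ.cox (aAtom n i j k) = (ρ (AAtom n k j i)).comap (ρ.proj i) := by
  induction n with
  | zero => intro i j k _; simp [AAtom, aAtom]
  | succ n ih =>
    intro i j k h
    constructor
    · simp only [AAtom, aAtom, map_sup, map_inf]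
      rw [(ih h.rot.rot).1, cox_y, cox_x]
      ext η
      simp only [Submodule.mem_comap, Submodule.mem_sup, Submodule.mem_inf, Submodule.mem_bot]
      constructor
      · rintro ⟨α, hα, β, ⟨hβ, hβ'⟩, rfl⟩
        refine ⟨_, hα, _, ⟨?_, ?_⟩, (map_add _ _ _).symm⟩ <;>
        · have e : ρ.proj i β = -ρ.proj k β := by
            have := ρ.proj_sum h β
            rw [hβ, add_zero] at this
            exact eq_neg_of_add_eq_zero_left this
          rw [e]
          first | exact neg_mem (ρ.proj_mem k β) | exact neg_mem hβ'
      · rintro ⟨a, ha, b, ⟨hb, hb'⟩, e⟩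
        -- Both φ_i η and a ∈ X_i lie in Y_i, so b lies in Y_i as well as in Y_k, and (b, 0, -b) is
        -- a vector of the space of Φ⁺ρ.
        have hbi : b ∈ ρ (y i) := by
          rw [← add_sub_cancel_left a b, e]
          exact sub_mem (ρ.proj_mem i η) (ρ.x_le_y i ha)
        obtain ⟨β, h₁, h₂, h₃⟩ := ρ.exists_proj h hbi (zero_mem _) (neg_mem hb) (by abel)
        refine ⟨η - β, ?_, β, ⟨h₂, ?_⟩, sub_add_cancel _ _⟩
        · rw [map_sub, h₁, ← e, add_sub_cancel_right]; exact ha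
        · rw [h₃]; exact neg_mem hb'
    · simp only [AAtom, aAtom, map_sup, map_inf]
      rw [(ih h.rot).2, cox_y, cox_x]
      ext η
      simp only [Submodule.mem_comap, Submodule.mem_sup, Submodule.mem_inf, Submodule.mem_bot]
      constructor
      · rintro ⟨α, hα, β, ⟨hβ, hβ'⟩, rfl⟩
        refine ⟨-ρ.proj k β, neg_mem (ρ.proj_mem k β), -ρ.proj j β,
          ⟨neg_mem hβ, neg_mem hβ'⟩, ?_⟩
        rw [map_add, hα, zero_add, ← neg_add, neg_eq_iff_add_eq_zero, ← ρ.proj_sum h β]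
        abel
      · rintro ⟨a, ha, b, ⟨hb, hb'⟩, e⟩
        obtain ⟨β, h₁, h₂, h₃⟩ := ρ.exists_proj h (ρ.proj_mem i η)
          (neg_mem (ρ.x_le_y j hb)) (neg_mem ha) (by rw [← e]; abel)
        refine ⟨η - β, ?_, β, ⟨?_, ?_⟩, sub_add_cancel _ _⟩
        · rw [map_sub, h₁, sub_self]
        · rw [h₂]; exact neg_mem hb
        · rw [h₂]; exact neg_mem hb'

/-- Modulo ker φ_i only φ_i(ker φ_j) matters, and it equals Y_i ∩ Y_k by the vectors (b, 0, -b).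
Thus a sum of two kernels becomes a preimage under a single projection. -/
theorem cox_x_sup_x (h : Distinct i j k) :
    ρ.cox (x i ⊔ x j) = (ρ (y i) ⊓ ρ (y k)).comap (ρ.proj i) := by
  rw [map_sup, cox_x, cox_x]
  ext η
  simp only [Submodule.mem_comap, Submodule.mem_sup, Submodule.mem_inf, Submodule.mem_bot]
  constructor
  · rintro ⟨α, hα, β, hβ, rfl⟩
    refine ⟨ρ.proj_mem i _, ?_⟩
    have e : ρ.proj i β = -ρ.proj k β := by
      have := ρ.proj_sum h β
      rw [hβ, add_zero] at this
      exact eq_neg_of_add_eq_zero_left this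
    rw [map_add, hα, zero_add, e]
    exact neg_mem (ρ.proj_mem k β)
  · rintro ⟨h₁, h₂⟩
    obtain ⟨β, h₁, h₂, h₃⟩ := ρ.exists_proj h h₁ (zero_mem _) (neg_mem h₂) (by abel)
    exact ⟨η - β, by rw [map_sub, h₁, sub_self], β, h₂, sub_add_cancel _ _⟩

end LinRep

/-! ## Admissible elements in terms of the numbers of rotations of a word -/

theorem x_le_AAtom (n : ℕ) (i j k : Fin 3) : x i ≤ AAtom n i j k := by
  cases n with
  | zero => exact le_top
  | succ n => exact (x_le_y i).trans le_sup_left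

theorem y_le_AAtom (n : ℕ) (i j k : Fin 3) : y i ≤ AAtom n i j k := by
  cases n with
  | zero => exact le_top
  | succ n => exact le_sup_left

theorem x_le_aAtom (n : ℕ) (i j k : Fin 3) : x i ≤ aAtom n i j k := by
  cases n with
  | zero => exact le_top
  | succ n => exact le_sup_left

theorem x_le_aAtom_snd (n : ℕ) (i j k : Fin 3) : x j ≤ aAtom n i j k := by
  cases n with
  | zero => exact le_top
  | succ n => exact (le_inf (x_le_y j) (x_le_aAtom n j k i)).trans le_sup_right

/-- The element `e_α` for a word `α` with first letter `i` in which (reading from the right) `u`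
letters are followed by their successor and `v` by their predecessor, for the cyclic order
`i → j → k → i`. -/
def eForm (u v : ℕ) (i j k : Fin 3) : D222 :=
  y i ⊓ AAtom (v / 2) j i k ⊓ AAtom ((v + 1) / 2) k j i ⊓ aAtom (u / 2) i k j ⊓
    aAtom ((u + 1) / 2) k j i

/-- The element `f_α` for a word `α` as in `eForm`. -/
def fForm (u v : ℕ) (i j k : Fin 3) : D222 :=
  if u % 2 = 0 then
    if v % 2 = 0 then x i ⊓ AAtom (v / 2) k j i ⊓ aAtom (u / 2) k j i
    else y i ⊓ y k ⊓ aAtom (u / 2) k j i ⊓ AAtom (v / 2) j i k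
  else
    if v % 2 = 0 then y i ⊓ y j ⊓ aAtom (u / 2) i k j ⊓ AAtom (v / 2) k j i
    else y i ⊓ (x j ⊔ x k) ⊓ AAtom (v / 2) j i k ⊓ aAtom (u / 2) i k j

/-- The projections `φ_j` and `φ_k` map the elements of the family `F` in `Φ⁺ρ` to elements of the
family, with the orientation reversed. -/
def IsStepFamily (K : Type u) [Field K] (F : ℕ → ℕ → Fin 3 → Fin 3 → Fin 3 → D222) : Prop :=
  ∀ (X : Type u) [AddCommGroup X] [Module K X] (ρ : LinRep K X) (i j k : Fin 3),
    Distinct i j k → ∀ u v : ℕ,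
      (ρ.cox (F u v i j k)).map (ρ.proj j) = ρ (F v (u + 1) j i k) ∧
      (ρ.cox (F u v i j k)).map (ρ.proj k) = ρ (F (v + 1) u k j i)

/-- The modular law in the form that pulls a factor out of the sum produced by `map_proj_of_box`,
leaving a new atomic element. -/
theorem inf_sup_inf_of_le {L : Type*} [Lattice L] [IsModularLattice L] {p q b : L}
    (h : p ≤ b) : p ⊔ q ⊓ b = b ⊓ (p ⊔ q) := by
  rw [inf_comm b, ← sup_inf_assoc_of_le q h]

section

variable {K : Type u} [Field K] {X : Type u} [AddCommGroup X] [Module K X]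

namespace LinRep

variable (ρ : LinRep K X) {i j k : Fin 3}

theorem cox_AAtom (h : Distinct i j k) (n : ℕ) :
    ρ.cox (AAtom n i j k) = (ρ (aAtom n i k j)).comap (ρ.proj i) :=
  (ρ.cox_AAtom_aAtom n h).1

theorem cox_aAtom (h : Distinct i j k) (n : ℕ) :
    ρ.cox (aAtom n i j k) = (ρ (AAtom n k j i)).comap (ρ.proj i) :=
  (ρ.cox_AAtom_aAtom n h).2

/-- The image under a projection of an element that is an intersection of three preimages. -/
theorem map_proj_of_box (h : Distinct i j k) {z p q r : D222} (hz : ρ.cox z =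
    (ρ p).comap (ρ.proj i) ⊓ (ρ q).comap (ρ.proj j) ⊓ (ρ r).comap (ρ.proj k)) :
    (ρ.cox z).map (ρ.proj k) = ρ ((y k ⊓ r) ⊓ (y i ⊓ p ⊔ y j ⊓ q)) := by
  rw [hz, ρ.map_proj_box h]
  simp only [map_inf, map_sup]

end LinRep

/-- In Φ⁺ρ the element is a box, an intersection of preimages under the three projections, so its
images are given by `map_proj_of_box`. The modular law isolates in the resulting sum one atomic
element of index u/2 + 1 or v/2 + 1; the remaining factors carry over with the two kinds of atomic
elements exchanged. -/
theorem isStepFamily_eForm : IsStepFamily K eForm := by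
  intro X _ _ ρ i j k h u v
  have hz : ρ.cox (eForm u v i j k) =
      (ρ (x i ⊓ AAtom (u / 2) j k i)).comap (ρ.proj i) ⊓
        (ρ (aAtom (v / 2) j k i)).comap (ρ.proj j) ⊓
        (ρ (aAtom ((v + 1) / 2) k i j ⊓ AAtom ((u + 1) / 2) i j k)).comap (ρ.proj k) := by
    rw [eForm]
    simp only [map_inf, Submodule.comap_inf]
    rw [ρ.cox_AAtom h.swap.rot.rot, ρ.cox_AAtom h.swap.rot, ρ.cox_aAtom h.swap,
      ρ.cox_aAtom h.swap.rot, LinRep.cox_y]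
    ac_rfl
  have hxy : x i ⊓ AAtom (u / 2) j k i ≤ y i := inf_le_left.trans (x_le_y i)
  constructor
  · rw [ρ.map_proj_of_box h.rot.rot (z := eForm u v i j k)
      (p := aAtom ((v + 1) / 2) k i j ⊓ AAtom ((u + 1) / 2) i j k)
      (q := x i ⊓ AAtom (u / 2) j k i) (r := aAtom (v / 2) j k i) (by rw [hz]; ac_rfl)]
    have := inf_sup_inf_of_le (q := y k)
      (le_inf (inf_le_left.trans (x_le_aAtom_snd ((v + 1) / 2) k i j))
        (inf_le_left.trans (x_le_AAtom ((u + 1) / 2) i j k)) :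
        x i ⊓ AAtom (u / 2) j k i ≤ aAtom ((v + 1) / 2) k i j ⊓ AAtom ((u + 1) / 2) i j k)
    rw [inf_eq_right.2 hxy, sup_comm, this, eForm,
      show (u + 1 + 1) / 2 = u / 2 + 1 by omega, AAtom, sup_comm (y k)]
    congr 1
    ac_rfl
  · have := inf_sup_inf_of_le (q := x i)
      (inf_le_left.trans (y_le_AAtom (u / 2) j k i) :
        y j ⊓ aAtom (v / 2) j k i ≤ AAtom (u / 2) j k i)
    rw [ρ.map_proj_of_box h hz, inf_eq_right.2 hxy, sup_comm, this, sup_comm, eForm,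
      show (v + 1 + 1) / 2 = v / 2 + 1 by omega, aAtom]
    congr 1
    ac_rfl

theorem isStepFamily_fForm : IsStepFamily K fForm := by
  intro X _ _ ρ i j k h u v
  have hA : ∀ n, x i ⊓ AAtom n j k i ≤ y i := fun n => inf_le_left.trans (x_le_y i)
  rcases Nat.mod_two_eq_zero_or_one u with hu | hu <;>
    rcases Nat.mod_two_eq_zero_or_one v with hv | hv
  -- Here x_i becomes ker φ_i. The zero subspace need not be a value of ρ, so `map_proj_box` has to
  -- be used instead of `map_proj_of_box`.
  · have hz : ρ.cox (fForm u v i j k) = (⊥ : Submodule K X).comap (ρ.proj i) ⊓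
        (ρ ⊤).comap (ρ.proj j) ⊓
        (ρ (aAtom (v / 2) k i j ⊓ AAtom (u / 2) i j k)).comap (ρ.proj k) := by
      simp only [fForm, hu, hv, if_true, map_inf, Submodule.comap_inf]
      rw [ρ.cox_AAtom h.swap.rot, ρ.cox_aAtom h.swap.rot, LinRep.cox_x, LinRep.apply_top,
        Submodule.comap_top, inf_top_eq, inf_assoc]
    constructor
    · have hz' : ρ.cox (fForm u v i j k) =
          (ρ (aAtom (v / 2) k i j ⊓ AAtom (u / 2) i j k)).comap (ρ.proj k) ⊓
          (⊥ : Submodule K X).comap (ρ.proj i) ⊓ (ρ ⊤).comap (ρ.proj j) := by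
        rw [hz]; ac_rfl
      rw [hz', ρ.map_proj_box h.rot.rot, fForm, if_pos hv, if_neg (by omega),
        show (u + 1) / 2 = u / 2 by omega]
      simp only [map_inf, LinRep.apply_top, inf_bot_eq, inf_top_eq, sup_bot_eq]
      ac_rfl
    · rw [hz, ρ.map_proj_box h, fForm, if_neg (by omega), if_pos hu,
        show (v + 1) / 2 = v / 2 by omega]
      simp only [map_inf, LinRep.apply_top, inf_bot_eq, inf_top_eq, bot_sup_eq]
      ac_rfl
  · have hz : ρ.cox (fForm u v i j k) = (ρ (x i)).comap (ρ.proj i) ⊓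
        (ρ (aAtom (v / 2) j k i)).comap (ρ.proj j) ⊓
        (ρ (x k ⊓ AAtom (u / 2) i j k)).comap (ρ.proj k) := by
      simp only [fForm, hu, hv, if_true, one_ne_zero, if_false, map_inf, Submodule.comap_inf]
      rw [ρ.cox_AAtom h.swap.rot.rot, ρ.cox_aAtom h.swap.rot, LinRep.cox_y, LinRep.cox_y]
      ac_rfl
    have hk : x k ⊓ AAtom (u / 2) i j k ≤ y k := inf_le_left.trans (x_le_y k)
    constructor
    · rw [ρ.map_proj_of_box h.rot.rot (z := fForm u v i j k) (p := x k ⊓ AAtom (u / 2) i j k)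
        (q := x i) (r := aAtom (v / 2) j k i) (by rw [hz]; ac_rfl)]
      have := inf_sup_inf_of_le (q := x k) (x_le_AAtom (u / 2) i j k)
      rw [inf_eq_right.2 hk, inf_eq_right.2 (x_le_y i), sup_comm, this, fForm,
        if_neg (by omega), if_neg (by omega), show (u + 1) / 2 = u / 2 by omega]
      congr 1
      ac_rfl
    · rw [ρ.map_proj_of_box h hz, inf_eq_right.2 hk, inf_eq_right.2 (x_le_y i), fForm,
        if_pos (by omega), if_pos hu, show (v + 1) / 2 = v / 2 + 1 by omega, aAtom]
  · have hz : ρ.cox (fForm u v i j k) = (ρ (x i ⊓ AAtom (u / 2) j k i)).comap (ρ.proj i) ⊓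
        (ρ (x j)).comap (ρ.proj j) ⊓ (ρ (aAtom (v / 2) k i j)).comap (ρ.proj k) := by
      simp only [fForm, hu, hv, if_true, one_ne_zero, if_false, map_inf, Submodule.comap_inf]
      rw [ρ.cox_AAtom h.swap.rot, ρ.cox_aAtom h.swap, LinRep.cox_y, LinRep.cox_y]
      ac_rfl
    constructor
    · rw [ρ.map_proj_of_box h.rot.rot (z := fForm u v i j k) (p := aAtom (v / 2) k i j)
        (q := x i ⊓ AAtom (u / 2) j k i) (r := x j) (by rw [hz]; ac_rfl)]
      have := inf_sup_inf_of_le (q := y k)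
        (inf_le_left.trans (x_le_aAtom_snd (v / 2) k i j) :
          x i ⊓ AAtom (u / 2) j k i ≤ aAtom (v / 2) k i j)
      rw [inf_eq_right.2 (hA _), inf_eq_right.2 (x_le_y j), sup_comm, this, fForm,
        if_pos hv, if_pos (by omega), show (u + 1) / 2 = u / 2 + 1 by omega, AAtom,
        sup_comm (y k)]
      congr 1
      ac_rfl
    · have := inf_sup_inf_of_le (q := x i)
        ((x_le_y j).trans (y_le_AAtom (u / 2) j k i))
      rw [ρ.map_proj_of_box h hz, inf_eq_right.2 (hA _), inf_eq_right.2 (x_le_y j), sup_comm, this,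
        fForm, if_neg (by omega), if_neg (by omega), show (v + 1) / 2 = v / 2 by omega]
      congr 1
      ac_rfl
  -- The factor x_j + x_k is left unexpanded: by `cox_x_sup_x` it is a preimage under φ_j and also
  -- under φ_k, and each of the two claims uses the projection it is about.
  · have hz : ρ.cox (fForm u v i j k) = ρ.cox (x j ⊔ x k) ⊓
        ((ρ (x i ⊓ AAtom (u / 2) j k i)).comap (ρ.proj i) ⊓
          (ρ (aAtom (v / 2) j k i)).comap (ρ.proj j)) := by
      simp only [fForm, hu, hv, one_ne_zero, if_false, map_inf, Submodule.comap_inf]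
      rw [ρ.cox_AAtom h.swap.rot.rot, ρ.cox_aAtom h.swap, LinRep.cox_y]
      ac_rfl
    constructor
    · rw [ρ.map_proj_of_box h.rot.rot (z := fForm u v i j k) (p := ⊤)
        (q := x i ⊓ AAtom (u / 2) j k i) (r := y j ⊓ y i ⊓ aAtom (v / 2) j k i) (by
          rw [hz, ρ.cox_x_sup_x h.rot, LinRep.apply_top, Submodule.comap_top, top_inf_eq]
          simp only [map_inf, Submodule.comap_inf]
          simp only [inf_comm, inf_left_comm, inf_assoc])]
      rw [inf_eq_right.2 (hA _), inf_top_eq, fForm, if_neg (by omega), if_pos (by omega),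
        show (u + 1) / 2 = u / 2 + 1 by omega, AAtom, ← inf_assoc (y j), ← inf_assoc (y j),
        inf_idem]
    · rw [ρ.map_proj_of_box h (z := fForm u v i j k) (p := x i ⊓ AAtom (u / 2) j k i)
        (q := aAtom (v / 2) j k i) (r := y k ⊓ y i) (by
          rw [hz, sup_comm (x j), ρ.cox_x_sup_x h.swap.rot]
          simp only [map_inf]
          ac_rfl)]
      have := inf_sup_inf_of_le (q := x i)
        (inf_le_left.trans (y_le_AAtom (u / 2) j k i) :
          y j ⊓ aAtom (v / 2) j k i ≤ AAtom (u / 2) j k i)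
      rw [inf_eq_right.2 (hA _), sup_comm, this, sup_comm, fForm, if_pos (by omega),
        if_neg (by omega), show (v + 1) / 2 = v / 2 + 1 by omega, aAtom, ← inf_assoc (y k),
        inf_idem]
      congr 1
      ac_rfl

/-! ### Independence of the orientation -/

/-- Both sides are images under one projection of elements of Φ⁺ρ that agree by induction on the
number of steps. Hence the value does not depend on the cyclic order in which the element is
written. -/
theorem IsStepFamily.symm {F : ℕ → ℕ → Fin 3 → Fin 3 → Fin 3 → D222} (hF : IsStepFamily K F)
    (h0 : ∀ i j k, F 0 0 i j k = F 0 0 i k j) (n : ℕ) :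
    ∀ {u v : ℕ}, u + v = n → ∀ {X : Type u} [AddCommGroup X] [Module K X] (ρ : LinRep K X)
      {i j k : Fin 3}, Distinct i j k → ρ (F u v i j k) = ρ (F v u i k j) := by
  induction n with
  | zero =>
    intro u v huv X _ _ ρ i j k _
    obtain ⟨rfl, rfl⟩ : u = 0 ∧ v = 0 := by omega
    rw [h0]
  | succ n ih =>
    intro u v huv X _ _ ρ i j k h
    rcases u with _ | u
    · obtain rfl : v = n + 1 := by omega
      rw [← (hF X ρ j i k h.swap.rot.rot n 0).1, ih (by omega) ρ.cox h.swap.rot.rot,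
        ← (hF X ρ j k i h.rot 0 n).2]
    · rw [← (hF X ρ k j i h.swap.rot v u).2, ih (by omega) ρ.cox h.swap.rot,
        ← (hF X ρ k i j h.rot.rot u v).1]

/-- `φ_j` adds a successor step, and `φ_k` adds a predecessor step. -/
theorem IsStepFamily.step {F : ℕ → ℕ → Fin 3 → Fin 3 → Fin 3 → D222} (hF : IsStepFamily K F)
    (h0 : ∀ i j k, F 0 0 i j k = F 0 0 i k j) (ρ : LinRep K X) {i j k : Fin 3}
    (h : Distinct i j k) (u v : ℕ) :
    (ρ.cox (F u v i j k)).map (ρ.proj j) = ρ (F (u + 1) v j k i) ∧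
      (ρ.cox (F u v i j k)).map (ρ.proj k) = ρ (F u (v + 1) k i j) := by
  rw [(hF X ρ i j k h u v).1, (hF X ρ i j k h u v).2]
  exact ⟨hF.symm h0 _ rfl ρ h.swap.rot.rot, hF.symm h0 _ rfl ρ h.swap.rot⟩

theorem eForm_zero (i j k : Fin 3) : eForm 0 0 i j k = y i := by
  simp [eForm, AAtom, aAtom]

theorem fForm_zero (i j k : Fin 3) : fForm 0 0 i j k = x i := by
  simp [fForm, AAtom, aAtom]

end

/-! ## The rows of the table -/

theorem fForm_even_even (a b : ℕ) (i j k : Fin 3) :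
    fForm (2 * a) (2 * b) i j k = x i ⊓ AAtom b k j i ⊓ aAtom a k j i := by
  rw [fForm, if_pos (by omega), if_pos (by omega)]
  simp only [show 2 * a / 2 = a by omega, show 2 * b / 2 = b by omega]

theorem fForm_even_odd (a b : ℕ) (i j k : Fin 3) :
    fForm (2 * a) (2 * b + 1) i j k = y i ⊓ y k ⊓ aAtom a k j i ⊓ AAtom b j i k := by
  rw [fForm, if_pos (by omega), if_neg (by omega)]
  simp only [show 2 * a / 2 = a by omega, show (2 * b + 1) / 2 = b by omega]

theorem fForm_odd_even (a b : ℕ) (i j k : Fin 3) :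
    fForm (2 * a + 1) (2 * b) i j k = y i ⊓ y j ⊓ aAtom a i k j ⊓ AAtom b k j i := by
  rw [fForm, if_neg (by omega), if_pos (by omega)]
  simp only [show (2 * a + 1) / 2 = a by omega, show 2 * b / 2 = b by omega]

theorem fForm_odd_odd (a b : ℕ) (i j k : Fin 3) :
    fForm (2 * a + 1) (2 * b + 1) i j k =
      y i ⊓ (x j ⊔ x k) ⊓ AAtom b j i k ⊓ aAtom a i k j := by
  rw [fForm, if_neg (by omega), if_neg (by omega)]
  simp only [show (2 * a + 1) / 2 = a by omega, show (2 * b + 1) / 2 = b by omega]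

theorem eForm_even_even (a b : ℕ) (i j k : Fin 3) :
    eForm (2 * a) (2 * b) i j k =
      y i ⊓ AAtom b j i k ⊓ AAtom b k j i ⊓ aAtom a i k j ⊓ aAtom a k j i := by
  simp only [eForm, show 2 * a / 2 = a by omega, show 2 * b / 2 = b by omega,
    show (2 * a + 1) / 2 = a by omega, show (2 * b + 1) / 2 = b by omega]

theorem eForm_even_odd (a b : ℕ) (i j k : Fin 3) :
    eForm (2 * a) (2 * b + 1) i j k =
      y i ⊓ AAtom b j i k ⊓ AAtom (b + 1) k j i ⊓ aAtom a i k j ⊓ aAtom a k j i := by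
  simp only [eForm, show 2 * a / 2 = a by omega, show (2 * b + 1) / 2 = b by omega,
    show (2 * a + 1) / 2 = a by omega, show (2 * b + 1 + 1) / 2 = b + 1 by omega]

theorem eForm_odd_even (a b : ℕ) (i j k : Fin 3) :
    eForm (2 * a + 1) (2 * b) i j k =
      y i ⊓ AAtom b j i k ⊓ AAtom b k j i ⊓ aAtom a i k j ⊓ aAtom (a + 1) k j i := by
  simp only [eForm, show (2 * a + 1) / 2 = a by omega, show 2 * b / 2 = b by omega,
    show (2 * a + 1 + 1) / 2 = a + 1 by omega, show (2 * b + 1) / 2 = b by omega]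

theorem eForm_odd_odd (a b : ℕ) (i j k : Fin 3) :
    eForm (2 * a + 1) (2 * b + 1) i j k =
      y i ⊓ AAtom b j i k ⊓ AAtom (b + 1) k j i ⊓ aAtom a i k j ⊓ aAtom (a + 1) k j i := by
  simp only [eForm, show (2 * a + 1) / 2 = a by omega, show (2 * b + 1) / 2 = b by omega,
    show (2 * a + 1 + 1) / 2 = a + 1 by omega, show (2 * b + 1 + 1) / 2 = b + 1 by omega]

/-- The numbers of successor and predecessor steps of the word of a row. -/
def rowSteps (p k : ℕ) : ℕ → ℕ × ℕ
  | 1 => (2 * (k + 3 * p), 2 * (k - 1) + 1)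
  | 2 => (2 * (k + 3 * p) + 1, 2 * (k - 1) + 1)
  | 3 => (2 * (k + 3 * p + 1), 2 * (k - 1) + 1)
  | 4 => (2 * (k + 3 * p + 1) + 1, 2 * (k - 1) + 1)
  | 5 => (2 * (k + 3 * p + 2), 2 * (k - 1) + 1)
  | 6 => (2 * (k + 3 * p + 2) + 1, 2 * (k - 1) + 1)
  | 7 => (2 * k, 2 * k)
  | 8 => (2 * k + 1, 2 * k + 1)
  | 9 => (2 * (k + 3 * p) + 1, 2 * k)
  | 10 => (2 * (k + 3 * p + 1), 2 * k)
  | 11 => (2 * (k + 3 * p + 1) + 1, 2 * k)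
  | 12 => (2 * (k + 3 * p + 2), 2 * k)
  | 13 => (2 * (k + 3 * p + 2) + 1, 2 * k)
  | _ => (2 * (k + 3 * p + 3), 2 * k)

/-- The total rotation of `u` successor and `v` predecessor steps. -/
def rotation (u v : ℕ) : Fin 3 := ⟨(u + 2 * v) % 3, Nat.mod_lt _ (by norm_num)⟩

/-- The element of the family `F` for words with last letter `τ 0`, in the cyclic order
`τ 0 → τ 1 → τ 2 → τ 0`. -/
def oriented (F : ℕ → ℕ → Fin 3 → Fin 3 → Fin 3 → D222) (τ : Fin 3 → Fin 3) (u v : ℕ) : D222 :=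
  F u v (τ (rotation u v)) (τ (rotation u v + 1)) (τ (rotation u v + 2))

/-- The element of the family `F` as in `oriented`, computed from the reversed cyclic order. -/
def orientedRev (F : ℕ → ℕ → Fin 3 → Fin 3 → Fin 3 → D222) (τ : Fin 3 → Fin 3) (u v : ℕ) : D222 :=
  F v u (τ (rotation u v)) (τ (rotation u v + 2)) (τ (rotation u v + 1))

theorem rotation_eq {u v : ℕ} {r : Fin 3} (h : (u + 2 * v) % 3 = r.1) : rotation u v = r :=
  Fin.ext h

theorem getLast_append_wordPow (L : List (Fin 3)) (a b : Fin 3) (m : ℕ) :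
    (L ++ wordPow [a, b] (m + 1)).getLast? = some b := by
  rw [wordPow_succ, ← List.append_assoc, List.getLast?_append]
  simp

theorem row_word {i₁ i₂ i₃ : Fin 3} {p k line : ℕ} (h₁ : 1 ≤ line) (h₂ : line ≤ 14)
    (hk : line ≤ 6 → 0 < k) :
    (admRow i₁ i₂ i₃ p k line).word.length = (rowSteps p k line).1 + (rowSteps p k line).2 + 1 ∧
      (admRow i₁ i₂ i₃ p k line).word.getLast? = some i₁ := by
  have key (L : List (Fin 3)) (m : ℕ) (hm : 0 < m) :
      (L ++ wordPow [i₂, i₁] m).getLast? = some i₁ := by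
    obtain ⟨m, rfl⟩ : ∃ m', m = m' + 1 := ⟨m - 1, by omega⟩
    exact getLast_append_wordPow L i₂ i₁ m
  interval_cases line <;> refine ⟨?_, ?_⟩
  all_goals first
    | (simp only [admRow, rowSteps, List.length_append, wordPow_length, List.length_cons,
        List.length_nil]; omega)
    | (simp only [admRow, ← List.append_assoc]; exact key _ _ (by omega))
    | skip
  rcases k with _ | k
  · simp [admRow, wordPow]
  · exact key [i₁] (2 * (k + 1)) (by omega)

-- Each row of the table is the uniform expression for its step numbers, written in one of the two
-- cyclic orders. By `IsStepFamily.symm` it is immaterial which one.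
set_option maxHeartbeats 1600000 in
theorem row_form (σ : Fin 3 → Fin 3) {p k line : ℕ} (h₁ : 1 ≤ line) (h₂ : line ≤ 14)
    (hk : line ≤ 6 → 0 < k) :
    ((admRow (σ 0) (σ 1) (σ 2) p k line).f =
        oriented fForm σ (rowSteps p k line).1 (rowSteps p k line).2 ∧
      (admRow (σ 0) (σ 1) (σ 2) p k line).e =
        oriented eForm σ (rowSteps p k line).1 (rowSteps p k line).2) ∨
    ((admRow (σ 0) (σ 1) (σ 2) p k line).f =
        orientedRev fForm σ (rowSteps p k line).1 (rowSteps p k line).2 ∧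
      (admRow (σ 0) (σ 1) (σ 2) p k line).e =
        orientedRev eForm σ (rowSteps p k line).1 (rowSteps p k line).2) := by
  have e₀ (h : 0 < 3) : (⟨0, h⟩ : Fin 3) = 0 := rfl
  have e₅ (h : 1 < 3) : (⟨1, h⟩ : Fin 3) = 1 := rfl
  have e₆ (h : 2 < 3) : (⟨2, h⟩ : Fin 3) = 2 := rfl
  have e₁ : (1 : Fin 3) + 1 = 2 := rfl
  have e₂ : (1 : Fin 3) + 2 = 0 := rfl
  have e₃ : (2 : Fin 3) + 1 = 0 := rfl
  have e₄ : (2 : Fin 3) + 2 = 1 := rfl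
  have hr : rotation (rowSteps p k line).1 (rowSteps p k line).2 =
      ⟨(if line ≤ 6 then line else if line ≤ 8 then 0 else line + 1) % 3, Nat.mod_lt _ (by norm_num)⟩ := by
    apply rotation_eq
    interval_cases line <;>
      simp only [rowSteps, Nat.reduceLeDiff, if_true, if_false, Nat.reduceAdd, Nat.reduceMod] <;>
      omega
  rw [oriented, oriented, orientedRev, orientedRev, hr]
  clear hr
  interval_cases line
  all_goals
    simp only [Nat.reduceLeDiff, if_true, if_false, Nat.reduceAdd, Nat.reduceMod, e₀, e₅, e₆,
      zero_add, e₁, e₂, e₃, e₄, rowSteps, admRow]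
  -- Rows 1, 3, 5, 9, 11, 13 are written in the cyclic order of σ, all others in the reversed one.
  on_goal 1 => left
  on_goal 3 => left
  on_goal 5 => left
  on_goal 9 => left
  on_goal 11 => left
  on_goal 13 => left
  all_goals try right
  all_goals
    refine ⟨?_, ?_⟩ <;>
    simp only [fForm_even_even, fForm_even_odd, fForm_odd_even, fForm_odd_odd, eForm_even_even,
      eForm_even_odd, eForm_odd_even, eForm_odd_odd] <;>
    try rw [Nat.sub_add_cancel (hk (by norm_num))]
  all_goals try simp only [add_assoc, Nat.reduceAdd]
  all_goals ac_rfl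

/-- Rows 7 and 8 cover u = v. Otherwise the parity of v decides between γ (odd) and β (even), and
writing u - v - 1 = 6p + r with r < 6 gives p and the place in the block of six rows. The bounds on
p and k are those imposed by `admIndices`. -/
theorem exists_row {u v : ℕ} (h : v ≤ u) :
    ∃ p k line : ℕ, 1 ≤ line ∧ line ≤ 14 ∧ (line ≤ 6 → 0 < k) ∧ p ≤ u + v + 1 ∧ k ≤ u + v + 1 ∧
      rowSteps p k line = (u, v) := by
  rcases h.eq_or_lt with rfl | h
  · rcases Nat.even_or_odd' v with ⟨k, rfl | rfl⟩
    · exact ⟨0, k, 7, by omega, by omega, by omega, by omega, by omega, rfl⟩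
    · exact ⟨0, k, 8, by omega, by omega, by omega, by omega, by omega, rfl⟩
  · obtain ⟨d, rfl⟩ : ∃ d, u = v + 1 + d := ⟨u - (v + 1), by omega⟩
    obtain ⟨p, r, hr, rfl⟩ : ∃ p r, r < 6 ∧ d = 6 * p + r :=
      ⟨d / 6, d % 6, Nat.mod_lt _ (by norm_num), (Nat.div_add_mod d 6).symm⟩
    rcases Nat.even_or_odd' v with ⟨k, rfl | rfl⟩
    · refine ⟨p, k, 9 + r, by omega, by omega, by omega, by omega, by omega, ?_⟩
      interval_cases r <;> simp only [rowSteps, Prod.mk.injEq, Nat.reduceAdd, and_true] <;>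
        omega
    · refine ⟨p, k + 1, 1 + r, by omega, by omega, by omega, by omega, by omega, ?_⟩
      interval_cases r <;> simp only [rowSteps, Prod.mk.injEq, Nat.reduceAdd] <;>
        omega

/-! ### Sums over the table as sums over pairs of step numbers -/

theorem distinct_add (r : Fin 3) : Distinct r (r + 1) (r + 2) := by
  revert r
  intro r
  fin_cases r <;> exact ⟨by decide, by decide, by decide⟩

theorem Distinct.map {i j k : Fin 3} (h : Distinct i j k) (σ : Equiv.Perm (Fin 3)) :
    Distinct (σ i) (σ j) (σ k) :=
  ⟨σ.injective.ne h.ij, σ.injective.ne h.jk, σ.injective.ne h.ik⟩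

theorem perm_eq_add_or_sub : ∀ σ : Equiv.Perm (Fin 3),
    (∀ s, σ s = σ 0 + s) ∨ ∀ s, σ s = σ 0 - s := by
  decide

theorem rotation_swap (u v : ℕ) : rotation v u = -rotation u v := by
  have h : ∀ a b : Fin 3, (a.1 + b.1) % 3 = 0 → a = -b := by decide
  refine h _ _ ?_
  simp only [rotation]
  omega

theorem rotation_succ_left (u v : ℕ) : rotation (u + 1) v = rotation u v + 1 := by
  refine Fin.ext ?_
  simp only [rotation, Fin.val_add, Fin.val_one]
  omega

theorem rotation_succ_right (u v : ℕ) : rotation u (v + 1) = rotation u v + 2 := by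
  refine Fin.ext ?_
  simp only [rotation, Fin.val_add, Fin.val_two]
  omega

section

variable {K : Type u} [Field K] {X : Type u} [AddCommGroup X] [Module K X]
  {F : ℕ → ℕ → Fin 3 → Fin 3 → Fin 3 → D222}

/-- The members of the family for words that end in `t`, in the standard cyclic order. -/
def standard (F : ℕ → ℕ → Fin 3 → Fin 3 → Fin 3 → D222) (t : Fin 3) (u v : ℕ) : D222 :=
  oriented F (t + ·) u v

theorem IsStepFamily.orientedRev_eq (hF : IsStepFamily K F) (h0 : ∀ i j k, F 0 0 i j k = F 0 0 i k j)
    (ρ : LinRep K X) (σ : Equiv.Perm (Fin 3)) (u v : ℕ) :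
    ρ (orientedRev F σ u v) = ρ (oriented F σ u v) :=
  hF.symm h0 _ rfl ρ ((distinct_add _).swap.map σ)

/-- A permutation of the three indices is a rotation or a reflection of the cycle, and a reflection
exchanges forward and backward steps. -/
theorem IsStepFamily.oriented_eq (hF : IsStepFamily K F) (h0 : ∀ i j k, F 0 0 i j k = F 0 0 i k j)
    (ρ : LinRep K X) (σ : Equiv.Perm (Fin 3)) (u v : ℕ) :
    ρ (oriented F σ u v) = ρ (standard F (σ 0) u v) ∨
      ρ (oriented F σ u v) = ρ (standard F (σ 0) v u) := by
  have h := perm_eq_add_or_sub σ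
  generalize σ 0 = t at h ⊢
  rcases h with h | h
  · left
    simp only [standard, oriented, h]
  · right
    have e₁ : ∀ a r : Fin 3, a - (r + 1) = a + (-r + 2) := by decide
    have e₂ : ∀ a r : Fin 3, a - (r + 2) = a + (-r + 1) := by decide
    rw [← hF.orientedRev_eq h0]
    simp only [standard, oriented, orientedRev, h, rotation_swap u v, e₁, e₂, sub_eq_add_neg]

/-- Up to value, the rows of length n + 1 ending in t are the pairs (u, v) with u + v = n. Several
rows may give the same pair, which does no harm in a supremum. -/
theorem IsStepFamily.apply_sup' (hF : IsStepFamily K F) (h0 : ∀ i j k, F 0 0 i j k = F 0 0 i k j)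
    (ρ : LinRep K X) (g : AdmRow → D222)
    (hg : ∀ (σ : Fin 3 → Fin 3) {p k line : ℕ}, 1 ≤ line → line ≤ 14 → (line ≤ 6 → 0 < k) →
      g (admRow (σ 0) (σ 1) (σ 2) p k line) =
          oriented F σ (rowSteps p k line).1 (rowSteps p k line).2 ∨
        g (admRow (σ 0) (σ 1) (σ 2) p k line) =
          orientedRev F σ (rowSteps p k line).1 (rowSteps p k line).2)
    (t : Fin 3) (n : ℕ) (hn : (admIndices t (n + 1)).Nonempty) :
    ρ ((admIndices t (n + 1)).sup' hn fun s => g (rowOf s)) =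
      ⨆ m ∈ Finset.HasAntidiagonal.antidiagonal n, ρ (standard F t m.1 m.2) := by
  have key (σ : Equiv.Perm (Fin 3)) {p k line : ℕ} (h₁ : 1 ≤ line) (h₂ : line ≤ 14)
      (hk : line ≤ 6 → 0 < k) : ρ (g (rowOf (σ, p, k, line))) =
        ρ (oriented F σ (rowSteps p k line).1 (rowSteps p k line).2) := by
    rcases hg σ (p := p) h₁ h₂ hk with h | h
    · exact congrArg ρ h
    · exact (congrArg ρ h).trans (hF.orientedRev_eq h0 ρ σ _ _)
  rw [map_finset_sup']
  apply le_antisymm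
  · refine Finset.sup'_le _ _ ?_
    rintro ⟨σ, p, k, line⟩ hs
    obtain ⟨⟨-, -, h₁, h₂⟩, hk, hl, ht⟩ := mem_admIndices.1 hs
    obtain ⟨hl', ht'⟩ := row_word (i₁ := σ 0) (i₂ := σ 1) (i₃ := σ 2) (p := p) h₁ h₂ hk
    obtain rfl : σ 0 = t := Option.some_injective _ (ht'.symm.trans ht)
    have hn : (rowSteps p k line).1 + (rowSteps p k line).2 = n := by omega
    simp only [Function.comp_apply]
    rw [key σ h₁ h₂ hk]
    rcases hF.oriented_eq h0 ρ σ (rowSteps p k line).1 (rowSteps p k line).2 with h | h <;> rw [h]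
    · exact le_iSup₂_of_le ((rowSteps p k line).1, (rowSteps p k line).2)
        (Finset.HasAntidiagonal.mem_antidiagonal.2 hn) le_rfl
    · exact le_iSup₂_of_le ((rowSteps p k line).2, (rowSteps p k line).1)
        (Finset.HasAntidiagonal.mem_antidiagonal.2 ((add_comm _ _).trans hn)) le_rfl
  · refine iSup₂_le ?_
    rintro ⟨u, v⟩ hm
    rw [Finset.HasAntidiagonal.mem_antidiagonal] at hm
    dsimp only at hm ⊢
    have main (σ : Equiv.Perm (Fin 3)) (hσ : σ 0 = t) (a b : ℕ) (hab : b ≤ a) (h : a + b = n) :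
        ρ (oriented F σ a b) ≤ (admIndices t (n + 1)).sup' hn (ρ ∘ fun s => g (rowOf s)) := by
      obtain ⟨p, k, line, h₁, h₂, hk, hp, hk', hr⟩ := exists_row hab
      obtain ⟨hl', ht'⟩ := row_word (i₁ := σ 0) (i₂ := σ 1) (i₃ := σ 2) (p := p) h₁ h₂ hk
      rw [hr] at hl'
      have hmem : (σ, p, k, line) ∈ admIndices t (n + 1) :=
        mem_admIndices.2 ⟨⟨by omega, by omega, h₁, h₂⟩, hk, by rw [hl', h], by rw [ht', hσ]⟩
      have := key σ (p := p) h₁ h₂ hk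
      rw [hr] at this
      rw [← this]
      exact Finset.le_sup' (ρ ∘ fun s => g (rowOf s)) hmem
    rcases le_total v u with h | h
    -- The table only contains v ≤ u; the pairs with u < v come from the reflection s ↦ t - s.
    · exact main (Equiv.addLeft t) (add_zero t) u v h hm
    · have := main (Equiv.subLeft t) (sub_zero t) v u h (by omega)
      rw [← hF.orientedRev_eq h0] at this
      have e₁ : ∀ a r : Fin 3, a - (-r + 1) = a + (r + 2) := by decide
      have e₂ : ∀ a r : Fin 3, a - (-r + 2) = a + (r + 1) := by decide
      have e₃ : ∀ a r : Fin 3, a - (-r) = a + r := by decide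
      simpa only [standard, oriented, orientedRev, rotation_swap u v, e₁, e₂, e₃,
        Equiv.subLeft_apply] using this

theorem apply_xCum (ρ : LinRep K X) (t : Fin 3) (n : ℕ) :
    ρ (xCum t (n + 1)) = ⨆ m ∈ Finset.HasAntidiagonal.antidiagonal n, ρ (standard fForm t m.1 m.2) := by
  rw [xCum, dif_pos n.succ_pos]
  exact isStepFamily_fForm.apply_sup' (fun i j k => by rw [fForm_zero, fForm_zero]) ρ AdmRow.f
    (fun σ _ _ _ h₁ h₂ h₃ => (row_form σ h₁ h₂ h₃).imp And.left And.left) t n _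

theorem apply_yCum (ρ : LinRep K X) (t : Fin 3) (n : ℕ) :
    ρ (yCum t (n + 1)) = ⨆ m ∈ Finset.HasAntidiagonal.antidiagonal n, ρ (standard eForm t m.1 m.2) := by
  rw [yCum, dif_pos n.succ_pos]
  exact isStepFamily_eForm.apply_sup' (fun i j k => by rw [eForm_zero, eForm_zero]) ρ AdmRow.e
    (fun σ _ _ _ h₁ h₂ h₃ => (row_form σ h₁ h₂ h₃).imp And.right And.right) t n _

/-! ### Cumulative elements and the Coxeter functor -/

/-- The sum of the images under the three projections of a subspace of the space of `Φ⁺ρ`. -/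
def LinRep.push (ρ : LinRep K X) (W : Submodule K (LinRep.coxSpace ρ)) : Submodule K X :=
  ⨆ s, W.map (ρ.proj s)

theorem LinRep.push_sup (ρ : LinRep K X) (V W : Submodule K (LinRep.coxSpace ρ)) :
    ρ.push (V ⊔ W) = ρ.push V ⊔ ρ.push W := by
  simp only [LinRep.push, Submodule.map_sup, iSup_sup_eq]

@[simp] theorem LinRep.push_bot (ρ : LinRep K X) : ρ.push ⊥ = ⊥ := by
  simp [LinRep.push]

theorem LinRep.push_eq (ρ : LinRep K X) {i j k : Fin 3} (h : Distinct i j k)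
    (W : Submodule K (LinRep.coxSpace ρ)) : ρ.push W = W.map (ρ.proj j) ⊔ W.map (ρ.proj k) := by
  apply le_antisymm
  · refine iSup_le (h.forall_iff.2 ⟨?_, le_sup_left, le_sup_right⟩)
    rintro _ ⟨η, hη, rfl⟩
    have e : ρ.proj i η = -(ρ.proj j η + ρ.proj k η) := by
      rw [eq_neg_iff_add_eq_zero, ← add_assoc]
      exact ρ.proj_sum h η
    rw [e]
    exact neg_mem (Submodule.add_mem_sup ⟨η, hη, rfl⟩ ⟨η, hη, rfl⟩)
  · exact sup_le (le_iSup (fun s => W.map (ρ.proj s)) j) (le_iSup (fun s => W.map (ρ.proj s)) k)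

/-- The image under the projection indexed by the current first letter is redundant, since the
projections add up to zero. The other two prepend a forward and a backward step. -/
theorem IsStepFamily.push_standard (hF : IsStepFamily K F)
    (h0 : ∀ i j k, F 0 0 i j k = F 0 0 i k j) (ρ : LinRep K X) (t : Fin 3) (u v : ℕ) :
    ρ.push (ρ.cox (standard F t u v)) =
      ρ (standard F t (u + 1) v) ⊔ ρ (standard F t u (v + 1)) := by
  have h := (distinct_add (rotation u v)).map (Equiv.addLeft t)
  have e₁ : ∀ r : Fin 3, r + 1 + 1 = r + 2 := by decide
  have e₂ : ∀ r : Fin 3, r + 1 + 2 = r := by decide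
  have e₃ : ∀ r : Fin 3, r + 2 + 1 = r := by decide
  have e₄ : ∀ r : Fin 3, r + 2 + 2 = r + 1 := by decide
  have hs := hF.step h0 ρ h u v
  simp only [Equiv.coe_addLeft] at h hs
  rw [ρ.push_eq h]
  simp only [standard, oriented, rotation_succ_left, rotation_succ_right, e₁, e₂, e₃, e₄]
  rw [hs.1, hs.2]

theorem IsStepFamily.push_iSup (hF : IsStepFamily K F)
    (h0 : ∀ i j k, F 0 0 i j k = F 0 0 i k j) (ρ : LinRep K X) (t : Fin 3) (n : ℕ) :
    ρ.push (⨆ m ∈ Finset.HasAntidiagonal.antidiagonal n, ρ.cox (standard F t m.1 m.2)) =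
      ⨆ m ∈ Finset.HasAntidiagonal.antidiagonal (n + 1), ρ (standard F t m.1 m.2) := by
  have hpush : ρ.push (⨆ m ∈ Finset.HasAntidiagonal.antidiagonal n, ρ.cox (standard F t m.1 m.2)) =
      ⨆ m ∈ Finset.HasAntidiagonal.antidiagonal n, ρ.push (ρ.cox (standard F t m.1 m.2)) := by
    simp only [LinRep.push, Submodule.map_iSup]
    rw [iSup_comm]
    exact iSup_congr fun m => iSup_comm
  rw [hpush]
  apply le_antisymm
  · refine iSup₂_le ?_
    rintro ⟨u, v⟩ hm
    rw [Finset.HasAntidiagonal.mem_antidiagonal] at hm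
    rw [hF.push_standard h0]
    dsimp only at hm ⊢
    exact sup_le
      (le_iSup₂_of_le (u + 1, v) (Finset.HasAntidiagonal.mem_antidiagonal.2 (by dsimp only; omega)) le_rfl)
      (le_iSup₂_of_le (u, v + 1) (Finset.HasAntidiagonal.mem_antidiagonal.2 (by dsimp only; omega)) le_rfl)
  · refine iSup₂_le ?_
    rintro ⟨u, v⟩ hm
    rw [Finset.HasAntidiagonal.mem_antidiagonal] at hm
    dsimp only at hm ⊢
    rcases u with _ | u
    · obtain rfl : v = n + 1 := by omega
      refine le_iSup₂_of_le (0, n) (Finset.HasAntidiagonal.mem_antidiagonal.2 (by simp)) ?_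
      rw [hF.push_standard h0]
      exact le_sup_right
    · refine le_iSup₂_of_le (u, v) (Finset.HasAntidiagonal.mem_antidiagonal.2 (by dsimp only; omega)) ?_
      rw [hF.push_standard h0]
      exact le_sup_left

theorem push_xCum (ρ : LinRep K X) (t : Fin 3) (n : ℕ) :
    ρ.push (ρ.cox (xCum t (n + 1))) = ρ (xCum t (n + 2)) := by
  rw [apply_xCum, apply_xCum]
  exact isStepFamily_fForm.push_iSup (fun i j k => by rw [fForm_zero, fForm_zero]) ρ t n

theorem push_yCum (ρ : LinRep K X) (t : Fin 3) (n : ℕ) :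
    ρ.push (ρ.cox (yCum t (n + 1))) = ρ (yCum t (n + 2)) := by
  rw [apply_yCum, apply_yCum]
  exact isStepFamily_eForm.push_iSup (fun i j k => by rw [eForm_zero, eForm_zero]) ρ t n

theorem apply_xCum_one (ρ : LinRep K X) (t : Fin 3) : ρ (xCum t 1) = ρ (x t) := by
  rw [apply_xCum]
  simp [standard, oriented, fForm_zero, rotation]

theorem apply_yCum_one (ρ : LinRep K X) (t : Fin 3) : ρ (yCum t 1) = ρ (y t) := by
  rw [apply_yCum]
  simp [standard, oriented, eForm_zero, rotation]

end

/-! ## Indecomposable representations -/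

section

variable {K : Type u} [Field K] {X : Type u} [AddCommGroup X] [Module K X]

namespace LinRep

/-- A line and a complementary hyperplane that are compatible with an indecomposable
representation: the hyperplane is zero. -/
theorem Indecomposable.ker_eq_bot {ρ : LinRep K X} (hρ : ρ.Indecomposable) (f : X →ₗ[K] K) {v : X}
    (hv : f v ≠ 0) (hx : ∀ i, v ∈ ρ (x i) ∨ ρ (x i) ≤ LinearMap.ker f)
    (hy : ∀ i, v ∈ ρ (y i) ∨ ρ (y i) ≤ LinearMap.ker f) : LinearMap.ker f = ⊥ := by
  have hc : IsCompl (Submodule.span K {v}) (LinearMap.ker f) := by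
    constructor
    · rw [Submodule.disjoint_def]
      intro w hw hw'
      obtain ⟨c, rfl⟩ := Submodule.mem_span_singleton.1 hw
      rw [LinearMap.mem_ker, map_smul, smul_eq_mul, mul_eq_zero] at hw'
      rw [hw'.resolve_right hv, zero_smul]
    · rw [codisjoint_iff, eq_top_iff]
      intro w _
      refine Submodule.mem_sup.2 ⟨(f w / f v) • v, Submodule.smul_mem _ _
        (Submodule.mem_span_singleton_self v), w - (f w / f v) • v, ?_, by abel⟩
      rw [LinearMap.mem_ker, map_sub, map_smul, smul_eq_mul, div_mul_cancel₀ _ hv, sub_self]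
  have hs (W : Submodule K X) (hW : v ∈ W ∨ W ≤ LinearMap.ker f) :
      Splits (Submodule.span K {v}) (LinearMap.ker f) W := by
    intro u hu w hw huw
    obtain ⟨c, rfl⟩ := Submodule.mem_span_singleton.1 hu
    have hcW : c • v ∈ W := by
      rcases hW with hW | hW
      · exact W.smul_mem c hW
      · have := hW huw
        rw [LinearMap.mem_ker, map_add, LinearMap.mem_ker.1 hw, add_zero, map_smul, smul_eq_mul,
          mul_eq_zero] at this
        rw [this.resolve_right hv, zero_smul]
        exact zero_mem W
    exact ⟨hcW, (W.add_mem_iff_right hcW).1 huw⟩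
  refine (hρ.eq_bot_or hc (fun i => hs _ (hx i)) fun i => hs _ (hy i)).resolve_left fun h => hv ?_
  rw [Submodule.span_singleton_eq_bot.1 h, map_zero]

theorem eq_bot_or_eq_top_of_ker_eq_bot {f : X →ₗ[K] K} (hf : LinearMap.ker f = ⊥)
    (W : Submodule K X) : W = ⊥ ∨ W = ⊤ := by
  refine or_iff_not_imp_left.2 fun hW => ?_
  obtain ⟨w, hw, hw0⟩ := W.exists_mem_ne_zero_of_ne_bot hW
  have hfw : f w ≠ 0 := fun h => hw0 (LinearMap.ker_eq_bot'.1 hf w h)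
  refine eq_top_iff.2 fun z _ => ?_
  have : z - (f z / f w) • w = 0 := LinearMap.ker_eq_bot'.1 hf _ (by
    rw [map_sub, map_smul, smul_eq_mul, div_mul_cancel₀ _ hfw, sub_self])
  rw [sub_eq_zero.1 this]
  exact W.smul_mem _ hw

/-- Take a functional f vanishing on Y_j + Y_k and a vector outside ker f lying as deep as possible
in the chain X_i ⊆ Y_i ⊆ X. Its span and ker f form a compatible decomposition, so ker f = 0. -/
theorem Indecomposable.of_sup_ne_top {ρ : LinRep K X} (hρ : ρ.Indecomposable) {i j k : Fin 3}
    (h : Distinct i j k) (hjk : ρ (y j) ⊔ ρ (y k) ≠ ⊤) :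
    ρ (y j) = ⊥ ∧ ρ (y k) = ⊥ ∧ ∀ W : Submodule K X, W = ⊥ ∨ W = ⊤ := by
  obtain ⟨f, hf0, hf⟩ := Submodule.exists_le_ker_of_lt_top _ (lt_top_iff_ne_top.2 hjk)
  have hyj := le_sup_left.trans hf
  have hyk := le_sup_right.trans hf
  have hker : LinearMap.ker f = ⊥ := by
    obtain ⟨v, hv, hx, hy⟩ : ∃ v, f v ≠ 0 ∧ (v ∈ ρ (x i) ∨ ρ (x i) ≤ LinearMap.ker f) ∧
        (v ∈ ρ (y i) ∨ ρ (y i) ≤ LinearMap.ker f) := by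
      by_cases hx : ρ (x i) ≤ LinearMap.ker f
      · by_cases hy : ρ (y i) ≤ LinearMap.ker f
        · obtain ⟨v, hv⟩ : ∃ v, f v ≠ 0 := by
            by_contra! hv
            exact hf0 (LinearMap.ext hv)
          exact ⟨v, hv, .inr hx, .inr hy⟩
        · obtain ⟨v, hv, hv'⟩ := SetLike.not_le_iff_exists.1 hy
          exact ⟨v, hv', .inr hx, .inl hv⟩
      · obtain ⟨v, hv, hv'⟩ := SetLike.not_le_iff_exists.1 hx
        exact ⟨v, hv', .inl hv, .inl (ρ.x_le_y i hv)⟩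
    exact hρ.ker_eq_bot f hv
      (h.forall_iff.2 ⟨hx, .inr ((ρ.x_le_y j).trans hyj), .inr ((ρ.x_le_y k).trans hyk)⟩)
      (h.forall_iff.2 ⟨hy, .inr hyj, .inr hyk⟩)
  exact ⟨eq_bot_iff.2 (hyj.trans hker.le), eq_bot_iff.2 (hyk.trans hker.le),
    eq_bot_or_eq_top_of_ker_eq_bot hker⟩

/-- Any two of the three subspaces `Y_i` span the space. -/
def Spanning (ρ : LinRep K X) : Prop := ∀ i j, i ≠ j → ρ (y i) ⊔ ρ (y j) = ⊤

/-- A vector of B lifts along φ_i because its negative lies in the sum of the other two Y's, which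
is all of X. -/
theorem Spanning.map_proj {ρ : LinRep K X} (hs : ρ.Spanning) (i : Fin 3) {B : Submodule K X}
    (hB : B ≤ ρ (y i)) : (B.comap (ρ.proj i)).map (ρ.proj i) = B := by
  have h := (distinct_add i).rot
  have := ρ.map_proj_box h ⊤ ⊤ B
  simpa only [Submodule.comap_top, top_inf_eq, inf_top_eq, inf_eq_right.2 hB,
    hs _ _ h.ij] using this

theorem Spanning.push_top {ρ : LinRep K X} (hs : ρ.Spanning) : ρ.push ⊤ = ⊤ := by
  have h (i : Fin 3) : ρ (y i) ≤ ρ.push ⊤ := by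
    conv_lhs => rw [← hs.map_proj i le_rfl]
    exact (Submodule.map_mono le_top).trans (le_iSup (fun s => (⊤ : Submodule K _).map _) i)
  rw [eq_top_iff, ← hs 0 1 (by decide)]
  exact sup_le (h 0) (h 1)

theorem Spanning.splits_map {ρ : LinRep K X} (hs : ρ.Spanning) {U V : Submodule K (coxSpace ρ)}
    (hUV : IsCompl U V) (h : IsCompl (ρ.push U) (ρ.push V)) (i : Fin 3) {B : Submodule K X}
    (hB : B ≤ ρ (y i)) (hsp : Splits U V (B.comap (ρ.proj i))) :
    Splits (ρ.push U) (ρ.push V) B := by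
  refine splits_of_le_sup h ?_
  have e := hs.map_proj i hB
  rw [hsp.eq_sup hUV, Submodule.map_sup] at e
  refine e.ge.trans (sup_le_sup (le_inf ?_ ?_) (le_inf ?_ ?_))
  · exact (Submodule.map_mono inf_le_left).trans (Submodule.map_comap_le _ _)
  · exact (Submodule.map_mono inf_le_right).trans (le_iSup (fun s => U.map (ρ.proj s)) i)
  · exact (Submodule.map_mono inf_le_left).trans (Submodule.map_comap_le _ _)
  · exact (Submodule.map_mono inf_le_right).trans (le_iSup (fun s => V.map (ρ.proj s)) i)

theorem mem_push {ρ : LinRep K X} {W : Submodule K (coxSpace ρ)} {w : X} :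
    w ∈ ρ.push W ↔ ∃ η ∈ W, ∃ ζ ∈ W, ρ.proj 1 η + ρ.proj 2 ζ = w := by
  rw [ρ.push_eq (i := 0) (j := 1) (k := 2) ⟨by decide, by decide, by decide⟩, Submodule.mem_sup]
  simp [Submodule.mem_map]

/-- A decomposition of Φ⁺ρ is pushed forward to one of ρ. `push` reaches all of X when ρ is
spanning, and it kills only the zero subspace, so one of the original summands vanishes. -/
theorem Indecomposable.cox {ρ : LinRep K X} (hρ : ρ.Indecomposable) (hs : ρ.Spanning) :
    ρ.cox.Indecomposable := by
  have hX := hρ.1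
  have hd : Distinct 0 1 2 := ⟨by decide, by decide, by decide⟩
  have hnt : Nontrivial (coxSpace ρ) := by
    by_contra hnt
    rw [not_nontrivial_iff_subsingleton] at hnt
    have : (⊤ : Submodule K X) = ⊥ := by
      rw [← hs.push_top, Subsingleton.elim (⊤ : Submodule K (coxSpace ρ)) ⊥, push_bot]
    exact top_ne_bot this
  refine indecomposable_of_splits fun U V hUV hx hy => ?_
  have hc : IsCompl (ρ.push U) (ρ.push V) := by
    constructor
    · rw [Submodule.disjoint_def]
      intro w hw hw'
      obtain ⟨u₁, hu₁, u₂, hu₂, hu⟩ := mem_push.1 hw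
      obtain ⟨v₁, hv₁, v₂, hv₂, hv⟩ := mem_push.1 hw'
      -- The difference of the two expressions for w is a vector with coordinates 0, φ₁(u₁ - v₁),
      -- φ₂(u₂ - v₂). As the kernels of the projections split, its U-component a has coordinates 0,
      -- φ₁u₁, φ₂u₂. These add up to w, and hence w = 0.
      obtain ⟨η, h₀, h₁, h₂⟩ := ρ.exists_proj hd (zero_mem _) (ρ.proj_mem 1 (u₁ - v₁))
        (ρ.proj_mem 2 (u₂ - v₂)) (by rw [map_sub, map_sub, zero_add, ← add_sub_add_comm, hu, hv,
          sub_self])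
      obtain ⟨a, ha, b, hb, rfl⟩ : ∃ a ∈ U, ∃ b ∈ V, a + b = η :=
        Submodule.mem_sup.1 (hUV.sup_eq_top ▸ Submodule.mem_top)
      have key (s : Fin 3) {u v : coxSpace ρ} (hu : u ∈ U) (hv : v ∈ V)
          (h : ρ.proj s (a + b) = ρ.proj s (u - v)) : ρ.proj s a = ρ.proj s u := by
        have hm : (a - u) + (b + v) ∈ ρ.cox (D222.x s) := by
          show ρ.proj s ((a - u) + (b + v)) = 0
          rw [show (a - u) + (b + v) = (a + b) - (u - v) by abel, map_sub, h, sub_self]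
        have := (hx s _ (sub_mem ha hu) _ (add_mem hb hv) hm).1
        have h' : ρ.proj s (a - u) = 0 := this
        rwa [map_sub, sub_eq_zero] at h'
      have k₀ := key 0 (zero_mem U) (zero_mem V) (by rw [h₀, sub_zero, map_zero])
      have h := ρ.proj_sum hd a
      rwa [k₀, map_zero, zero_add, key 1 hu₁ hv₁ h₁, key 2 hu₂ hv₂ h₂, hu] at h
    · rw [codisjoint_iff, ← push_sup, hUV.sup_eq_top, hs.push_top]
  have hbot {W : Submodule K (coxSpace ρ)} (h : ρ.push W = ⊥) : W = ⊥ := by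
    rw [eq_bot_iff]
    intro η hη
    have hp (s : Fin 3) : ρ.proj s η = 0 := by
      have : ρ.proj s η ∈ ρ.push W :=
        le_iSup (fun s => W.map (ρ.proj s)) s ⟨η, hη, rfl⟩
      rwa [h, Submodule.mem_bot] at this
    exact (Submodule.mem_bot K).2 (ρ.coxSpace_ext hd (by rw [hp, map_zero]) (by rw [hp, map_zero]))
  refine (hρ.eq_bot_or hc (fun i => ?_) fun i => ?_).imp hbot hbot
  · exact hs.splits_map hUV hc i (ρ.x_le_y i) (hy i)
  · refine hs.splits_map hUV hc i le_rfl fun u _ v _ _ => ?_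
    exact ⟨ρ.proj_mem i u, ρ.proj_mem i v⟩

/-- An indecomposable representation is simple projective, or `Φ⁺ρ` is indecomposable. -/
theorem Indecomposable.spanning_or {ρ : LinRep K X} (hρ : ρ.Indecomposable) :
    ρ.Spanning ∨ ∃ i, (∀ j, j ≠ i → ρ (y j) = ⊥) ∧ ∀ W : Submodule K X, W = ⊥ ∨ W = ⊤ := by
  by_cases hs : ρ.Spanning
  · exact .inl hs
  · right
    simp only [Spanning, not_forall] at hs
    obtain ⟨j, k, hjk, hs⟩ := hs
    obtain ⟨i, h⟩ : ∃ i, Distinct i j k := by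
      have : ∀ j k : Fin 3, j ≠ k → ∃ i, i ≠ j ∧ j ≠ k ∧ i ≠ k := by decide
      obtain ⟨i, h₁, h₂, h₃⟩ := this j k hjk
      exact ⟨i, h₁, h₂, h₃⟩
    obtain ⟨hj, hk, hW⟩ := hρ.of_sup_ne_top h hs
    exact ⟨i, h.forall_iff.2 ⟨fun h => absurd rfl h, fun _ => hj, fun _ => hk⟩, hW⟩

end LinRep

/-! ## The perfect elements in indecomposable representations -/

open LinRep

theorem LinRep.Spanning.x_le_yCum {ρ : LinRep K X} (hs : ρ.Spanning) (t : Fin 3) :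
    ρ (x t) ≤ ρ (yCum t 2) := by
  rw [← push_yCum, apply_yCum_one, ← hs.map_proj t (ρ.x_le_y t)]
  exact le_iSup (fun s => (ρ.cox (y t)).map (ρ.proj s)) t

theorem LinRep.Spanning.push_aGen {ρ : LinRep K X} (hs : ρ.Spanning) (i : Fin 3) (n : ℕ) :
    ρ (aGen i (n + 1)) = ρ.push (ρ.cox (aGen i n)) := by
  rcases n with _ | n
  -- Level 0 has no x-summands while level 1 does; for spanning ρ they are absorbed by y_j(2) and
  -- y_k(2).
  · simp only [aGen, map_sup, push_sup, ← apply_yCum_one, push_yCum]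
    have h (t : Fin 3) := hs.x_le_yCum t
    simp only [zero_add]
    rw [sup_assoc, sup_eq_right]
    refine sup_le ((?_ : _ ≤ _).trans le_sup_left) ((?_ : _ ≤ _).trans le_sup_right)
    · rw [apply_xCum_one]; exact h _
    · rw [apply_xCum_one]; exact h _
  · simp only [aGen, map_sup, push_sup, push_xCum, push_yCum]

theorem LinRep.Spanning.push_bGen {ρ : LinRep K X} (hs : ρ.Spanning) (i : Fin 3) (n : ℕ) :
    ρ (bGen i (n + 1)) = ρ.push (ρ.cox (bGen i n)) := by
  rw [bGen, map_sup, hs.push_aGen]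
  rcases n with _ | n
  · rw [← push_xCum, ← push_sup, apply_xCum_one]
    simp only [aGen, bGen, map_sup]
    congr 1
    ac_rfl
  · rw [← push_xCum, ← push_sup, bGen, map_sup]

theorem LinRep.Spanning.push_cGen {ρ : LinRep K X} (hs : ρ.Spanning) (i : Fin 3) (n : ℕ) :
    ρ (cGen i (n + 1)) = ρ.push (ρ.cox (cGen i n)) := by
  rw [cGen, map_sup, hs.push_aGen, ← push_yCum, ← push_sup]
  rcases n with _ | n
  · rw [apply_yCum_one, ← map_sup, cGen, aGen]
    congr 2
    fin_cases i
    · show y 1 ⊔ y 2 ⊔ y 0 = _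
      ac_rfl
    · show y 2 ⊔ y 0 ⊔ y 1 = _
      ac_rfl
    · rfl
  · rw [cGen, map_sup]

/-- The perfect elements distinguish four types of indecomposable representations (at level `n`);
all other ones do not distinguish the elements of the two cubes. -/
inductive HasType (ρ : LinRep K X) (n : ℕ) : Option (Option (Fin 4)) → Prop
  | zero (i : Fin 3) (hb : ρ (bGen i n) = ⊥) (hc : ∀ j, ρ (cGen j (n + 1)) = ⊥) :
      HasType ρ n none
  | full (ha : ∀ j, ρ (aGen j n) = ⊤) (hb : ∀ j, ρ (bGen j n) = ⊤)
      (hc : ∀ j, ρ (cGen j (n + 1)) = ⊤) : HasType ρ n (some none)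
  | arm (i : Fin 3) (ha : ∀ j, ρ (aGen j n) = if j = i then ⊥ else ⊤) (hb : ∀ j, ρ (bGen j n) = ⊤)
      (hc : ∀ j, ρ (cGen j (n + 1)) = if j = i then ⊥ else ⊤) : HasType ρ n (some (some i.castSucc))
  | center (ha : ∀ j, ρ (aGen j n) = ⊤) (hb : ∀ j, ρ (bGen j n) = ⊤)
      (hc : ∀ j, ρ (cGen j (n + 1)) = ⊥) : HasType ρ n (some (some (Fin.last 3)))

theorem HasType.succ {ρ : LinRep K X} (hs : ρ.Spanning) {n : ℕ} {τ : Option (Option (Fin 4))}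
    (h : HasType ρ.cox n τ) : HasType ρ (n + 1) τ := by
  have ha := hs.push_aGen (n := n)
  have hb := hs.push_bGen (n := n)
  have hc := hs.push_cGen (n := n + 1)
  have ht := hs.push_top
  cases h with
  | zero i hb' hc' =>
    exact .zero i (by rw [hb, hb', push_bot]) fun j => by rw [hc, hc', push_bot]
  | full ha' hb' hc' =>
    exact .full (fun j => by rw [ha, ha', ht]) (fun j => by rw [hb, hb', ht])
      fun j => by rw [hc, hc', ht]
  | arm i ha' hb' hc' =>
    refine .arm i (fun j => ?_) (fun j => by rw [hb, hb', ht]) fun j => ?_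
    · rw [ha, ha']; split
      · rw [push_bot]
      · rw [ht]
    · rw [hc, hc']; split
      · rw [push_bot]
      · rw [ht]
  | center ha' hb' hc' =>
    exact .center (fun j => by rw [ha, ha', ht]) (fun j => by rw [hb, hb', ht])
      fun j => by rw [hc, hc', push_bot]

theorem aGen_le_bGen (i : Fin 3) (n : ℕ) : aGen i n ≤ bGen i n := by
  cases n with
  | zero => simp only [aGen, bGen, sup_assoc]; exact le_sup_right
  | succ n => exact le_sup_left

theorem subsingleton_coxSpace {ρ : LinRep K X} {i : Fin 3} (hi : ∀ j, j ≠ i → ρ (y j) = ⊥) :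
    Subsingleton (coxSpace ρ) := by
  have hd := (distinct_add i).rot
  refine ⟨fun η ζ => ρ.coxSpace_ext hd ?_ ?_⟩
  · have h (η : coxSpace ρ) : ρ.proj (i + 1) η = 0 :=
      (Submodule.mem_bot K).1 (hi _ hd.ik ▸ ρ.proj_mem (i + 1) η)
    rw [h, h]
  · have h (η : coxSpace ρ) : ρ.proj (i + 2) η = 0 :=
      (Submodule.mem_bot K).1 (hi _ hd.jk ▸ ρ.proj_mem (i + 2) η)
    rw [h, h]

-- Since Φ⁺ρ = 0, the cumulative elements x_t(m), y_t(m) with m ≥ 2 vanish, and only x_t(1) and the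
-- generators themselves contribute. The result is nonzero only at level 0 with X_i the whole line.
open Classical in
theorem hasType_of_simple [Nontrivial X] {ρ : LinRep K X} {i : Fin 3} (hi : ∀ j, j ≠ i → ρ (y j) = ⊥)
    (hx : ρ (x i) = ⊥ ∨ ρ (x i) = ⊤) (n : ℕ) :
    HasType ρ n (if n = 0 ∧ ρ (x i) = ⊤ then some (some i.castSucc) else none) := by
  have hss := subsingleton_coxSpace hi
  have hpush (W : Submodule K (coxSpace ρ)) : ρ.push W = ⊥ := by
    rw [Subsingleton.elim W ⊥, push_bot]
  have hxC (t : Fin 3) (m : ℕ) : ρ (xCum t (m + 2)) = ⊥ := by rw [← push_xCum, hpush]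
  have hyC (t : Fin 3) (m : ℕ) : ρ (yCum t (m + 2)) = ⊥ := by rw [← push_yCum, hpush]
  have hx0 (j : Fin 3) (hj : j ≠ i) : ρ (x j) = ⊥ := eq_bot_iff.2 ((ρ.x_le_y j).trans (hi j hj).le)
  have hc₁ (j : Fin 3) : ρ (cGen j 1) = ρ (x (j + 1)) ⊔ ρ (x (j + 2)) := by
    simp only [cGen, aGen, map_sup, hyC, sup_bot_eq]
    rw [apply_xCum_one, apply_xCum_one]
  have hc₂ (j : Fin 3) (m : ℕ) : ρ (cGen j (m + 2)) = ⊥ := by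
    simp only [cGen, aGen, map_sup, hxC, hyC, sup_bot_eq]
  have hd := distinct_add i
  rcases n with _ | _ | n
  · rcases hx with hx | hx
    · have hne : ρ (x i) ≠ ⊤ := by
        rw [hx]
        exact bot_ne_top
      rw [if_neg fun h => hne h.2]
      have hx' (j : Fin 3) : ρ (x j) = ⊥ := by
        by_cases hj : j = i
        · rw [hj, hx]
        · exact hx0 j hj
      refine .zero i ?_ fun j => by rw [hc₁, hx', hx', sup_bot_eq]
      simp only [bGen, map_sup, hx, hi _ hd.ij.symm, hi _ hd.ik.symm, sup_bot_eq]
    · rw [if_pos ⟨rfl, hx⟩]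
      have hy : ρ (y i) = ⊤ := eq_top_iff.2 (hx ▸ ρ.x_le_y i)
      have key (g : Fin 3 → Submodule K X) (h₁ : g i = ⊤) (h₀ : ∀ s, s ≠ i → g s = ⊥) (j : Fin 3) :
          g (j + 1) ⊔ g (j + 2) = if j = i then ⊥ else ⊤ := by
        have : ∀ i j : Fin 3, (j = i ∧ j + 1 ≠ i ∧ j + 2 ≠ i) ∨ (j ≠ i ∧ j + 1 = i) ∨
            (j ≠ i ∧ j + 2 = i) := by decide
        rcases this i j with ⟨h, h', h''⟩ | ⟨h, h'⟩ | ⟨h, h'⟩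
        · rw [if_pos h, h₀ _ h', h₀ _ h'', sup_bot_eq]
        · rw [if_neg h, h', h₁, top_sup_eq]
        · rw [if_neg h, h', h₁, sup_top_eq]
      have ha (j : Fin 3) : ρ (aGen j 0) = if j = i then ⊥ else ⊤ := by
        rw [aGen, map_sup]
        exact key (fun s => ρ (y s)) hy hi j
      refine .arm i ha (fun j => ?_) fun j => ?_
      · by_cases hj : j = i
        · rw [bGen, map_sup, map_sup, hj, hx, top_sup_eq, top_sup_eq]
        · rw [eq_top_iff]
          have := ρ.mono (aGen_le_bGen j 0)
          rwa [ha, if_neg hj] at this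
      · rw [hc₁]
        exact key (fun s => ρ (x s)) hx hx0 j
  · rw [if_neg fun h => absurd h.1 (by omega)]
    refine .zero i ?_ fun j => hc₂ j 0
    simp only [zero_add, bGen, aGen, map_sup, hxC _ 0, hyC _ 0, sup_bot_eq]
    rw [apply_xCum_one, apply_xCum_one, hx0 _ hd.ij.symm, hx0 _ hd.ik.symm, sup_bot_eq]
  · rw [if_neg fun h => absurd h.1 (by omega)]
    refine .zero i ?_ fun j => hc₂ j _
    simp only [bGen, aGen, map_sup, hxC, hyC, sup_bot_eq]

-- Here c_j(1) is the push of y_1 + y_2 + y_3 from Φ⁺ρ. If that sum is not everything, then two of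
-- the Y's of Φ⁺ρ do not span, Φ⁺ρ has only trivial subspaces, and the sum is zero.
open Classical in
theorem hasType_zero_of_spanning {ρ : LinRep K X} (hs : ρ.Spanning) (h : ρ.cox.Indecomposable) :
    HasType ρ 0 (some (if ρ.cox (y 0 ⊔ y 1 ⊔ y 2) = ⊤ then none else some (Fin.last 3))) := by
  have ha (j : Fin 3) : ρ (aGen j 0) = ⊤ := by
    rw [aGen, map_sup]
    exact hs _ _ (distinct_add j).jk
  have hb (j : Fin 3) : ρ (bGen j 0) = ⊤ :=
    eq_top_iff.2 ((ha j).ge.trans (ρ.mono (aGen_le_bGen j 0)))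
  split_ifs with hT
  · exact .full ha hb fun j => by rw [hs.push_cGen, cGen, hT, hs.push_top]
  · refine .center ha hb fun j => ?_
    have hd : Distinct 2 0 1 := ⟨by decide, by decide, by decide⟩
    have hne : ρ.cox (y 0) ⊔ ρ.cox (y 1) ≠ ⊤ := fun he => hT (by
      rw [map_sup, map_sup, he, top_sup_eq])
    rw [hs.push_cGen, cGen, ((h.of_sup_ne_top hd hne).2.2 _).resolve_right hT, push_bot]

theorem LinRep.Indecomposable.hasType (n : ℕ) : ∀ {X : Type u} [AddCommGroup X] [Module K X]
    {ρ : LinRep K X}, ρ.Indecomposable → ∃ τ, HasType ρ n τ := by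
  induction n with
  | zero =>
    intro X _ _ ρ hρ
    rcases hρ.spanning_or with hs | ⟨i, hi, hW⟩
    · exact ⟨_, hasType_zero_of_spanning hs (hρ.cox hs)⟩
    · have := hρ.1
      exact ⟨_, hasType_of_simple hi (hW _) 0⟩
  | succ n ih =>
    intro X _ _ ρ hρ
    rcases hρ.spanning_or with hs | ⟨i, hi, hW⟩
    · obtain ⟨τ, h⟩ := ih (hρ.cox hs)
      exact ⟨τ, h.succ hs⟩
    · have := hρ.1
      exact ⟨_, hasType_of_simple hi (hW _) (n + 1)⟩

end

/-! ## The inverse Coxeter functor -/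

namespace LinRep

variable {K : Type u} [Field K] {X : Type u} [AddCommGroup X] [Module K X]

theorem Indecomposable.of_equiv {X' : Type u} [AddCommGroup X'] [Module K X'] {ρ : LinRep K X}
    {ρ' : LinRep K X'} (hρ : ρ.Indecomposable) (f : X ≃ₗ[K] X')
    (hf : ∀ a, (ρ a).map (f : X →ₗ[K] X') = ρ' a) : ρ'.Indecomposable := by
  have := hρ.1
  have := f.symm.toEquiv.nontrivial
  have hmem (a : D222) (z : X) : f z ∈ ρ' a ↔ z ∈ ρ a := by
    rw [← hf]
    constructor
    · rintro ⟨z', hz', h⟩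
      rwa [← f.injective h]
    · exact fun h => ⟨z, h, rfl⟩
  refine indecomposable_of_splits fun U V hUV hx hy => ?_
  let e : Submodule K X' ≃o Submodule K X := (Submodule.orderIsoMapComap f).symm
  have he (W : Submodule K X') (z : X) : z ∈ e W ↔ f z ∈ W := Iff.rfl
  have hs (a : D222) (h : Splits U V (ρ' a)) : Splits (e U) (e V) (ρ a) := by
    intro u hu v hv huv
    have := h (f u) hu (f v) hv (by rwa [← map_add, hmem])
    rwa [hmem, hmem] at this
  exact (hρ.eq_bot_or (e.isCompl hUV) (fun i => hs _ (hx i)) fun i => hs _ (hy i)).imp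
    (fun h => e.injective (h.trans (map_bot e).symm)) fun h => e.injective (h.trans (map_bot e).symm)

/-- A decomposition U ⊕ V of X is pulled back to the triples with all coordinates in U, respectively
in V. These triples decompose the space because the Y_i split. If those of V are everything, then V
contains every Y_i, hence V = X by spanning. -/
theorem indecomposable_of_cox {ρ : LinRep K X} (hs : ρ.Spanning) (h : ρ.cox.Indecomposable) :
    ρ.Indecomposable := by
  have hd : Distinct 0 1 2 := ⟨by decide, by decide, by decide⟩
  have hnt : Nontrivial X := by
    by_contra hX
    rw [not_nontrivial_iff_subsingleton] at hX
    obtain ⟨η, ζ, hηζ⟩ := h.1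
    exact hηζ (ρ.coxSpace_ext hd (Subsingleton.elim _ _) (Subsingleton.elim _ _))
  refine indecomposable_of_splits fun U V hUV hx hy => ?_
  let T (W : Submodule K X) : Submodule K (coxSpace ρ) := ⨅ i, W.comap (ρ.proj i)
  have hT (W : Submodule K X) (η : coxSpace ρ) : η ∈ T W ↔ ∀ i, ρ.proj i η ∈ W := by
    simp [T, Submodule.mem_iInf]
  have hsp (i : Fin 3) (B : Submodule K X) (hB : Splits U V B) :
      Splits (T U) (T V) (B.comap (ρ.proj i)) := fun u hu v hv huv =>
    hB _ ((hT _ _).1 hu i) _ ((hT _ _).1 hv i) (by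
      rw [← map_add]
      exact huv)
  have hc : IsCompl (T U) (T V) := by
    constructor
    · rw [Submodule.disjoint_def]
      intro η hU hV
      have h0 (i : Fin 3) : ρ.proj i η = 0 :=
        Submodule.disjoint_def.1 hUV.disjoint _ ((hT _ _).1 hU i) ((hT _ _).1 hV i)
      exact ρ.coxSpace_ext hd (by rw [h0, map_zero]) (by rw [h0, map_zero])
    · rw [codisjoint_iff, eq_top_iff]
      intro η _
      have hdec (i : Fin 3) : ∃ u ∈ U, ∃ v ∈ V, u + v = ρ.proj i η :=
        Submodule.mem_sup.1 (hUV.sup_eq_top ▸ Submodule.mem_top)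
      choose u hu v hv huv using hdec
      have hY (i : Fin 3) := hy i _ (hu i) _ (hv i) (by
        rw [huv]
        exact ρ.proj_mem i η)
      have h0 : u 0 + u 1 + u 2 = 0 ∧ v 0 + v 1 + v 2 = 0 := by
        refine eq_of_add_eq_add hUV.disjoint
          (add_mem (add_mem (hu 0) (hu 1)) (hu 2)) (zero_mem _)
          (add_mem (add_mem (hv 0) (hv 1)) (hv 2)) (zero_mem _) ?_
        rw [add_zero, ← ρ.proj_sum hd η, ← huv, ← huv, ← huv]
        abel
      obtain ⟨α, hα₀, hα₁, hα₂⟩ := ρ.exists_proj hd (hY 0).1 (hY 1).1 (hY 2).1 h0.1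
      obtain ⟨β, hβ₀, hβ₁, hβ₂⟩ := ρ.exists_proj hd (hY 0).2 (hY 1).2 (hY 2).2 h0.2
      refine Submodule.mem_sup.2 ⟨α, (hT _ _).2 (hd.forall_iff.2 ⟨?_, ?_, ?_⟩), β,
        (hT _ _).2 (hd.forall_iff.2 ⟨?_, ?_, ?_⟩), ρ.coxSpace_ext hd ?_ ?_⟩
      · rw [hα₀]; exact hu 0
      · rw [hα₁]; exact hu 1
      · rw [hα₂]; exact hu 2
      · rw [hβ₀]; exact hv 0
      · rw [hβ₁]; exact hv 1
      · rw [hβ₂]; exact hv 2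
      · rw [map_add, hα₀, hβ₀, huv]
      · rw [map_add, hα₁, hβ₁, huv]
  have htop {W : Submodule K X} (hW : T W = ⊤) : W = ⊤ := by
    have hle (i : Fin 3) : ρ (y i) ≤ W := by
      rw [← hs.map_proj i le_rfl]
      rintro _ ⟨η, -, rfl⟩
      exact (hT W η).1 (hW ▸ Submodule.mem_top) i
    rw [eq_top_iff, ← hs 0 1 (by decide)]
    exact sup_le (hle 0) (hle 1)
  -- Needed because the subspaces x_i of Φ⁺ρ are preimages of zero.
  have hbot : Splits U V ⊥ := fun u hu v hv huv => by
    have := eq_of_add_eq_add hUV.disjoint hu (zero_mem _) hv (zero_mem _)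
      (((Submodule.mem_bot K).1 huv).trans (add_zero 0).symm)
    exact ⟨(Submodule.mem_bot K).2 this.1, (Submodule.mem_bot K).2 this.2⟩
  rcases h.eq_bot_or hc (fun i => hsp i _ hbot) (fun i => hsp i _ (hx i)) with hU | hV
  · left
    have hV : V = ⊤ := htop (by rw [← hc.sup_eq_top, hU, bot_sup_eq])
    have := hUV.inf_eq_bot
    rwa [hV, inf_top_eq] at this
  · right
    have hU : U = ⊤ := htop (by rw [← hc.sup_eq_top, hV, sup_bot_eq])
    have := hUV.inf_eq_bot
    rwa [hU, top_inf_eq] at this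

/-- The relations in the space of `Φ⁻ρ`. -/
def relSpace (ρ : LinRep K X) : Submodule K (Fin 3 → X) where
  carrier := {ξ | ∃ z, ∀ i, ξ i - z ∈ ρ (x i)}
  add_mem' := by
    rintro ξ ζ ⟨z, hz⟩ ⟨w, hw⟩
    exact ⟨z + w, fun i => by
      rw [Pi.add_apply, add_sub_add_comm]
      exact add_mem (hz i) (hw i)⟩
  zero_mem' := ⟨0, fun i => by simp⟩
  smul_mem' := by
    rintro c ξ ⟨z, hz⟩
    exact ⟨c • z, fun i => by
      rw [Pi.smul_apply, ← smul_sub]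
      exact Submodule.smul_mem _ c (hz i)⟩

/-- The inclusion of the `i`-th summand into the space of `Φ⁻ρ`. -/
def incl (ρ : LinRep K X) (i : Fin 3) : X →ₗ[K] (Fin 3 → X) ⧸ ρ.relSpace :=
  ρ.relSpace.mkQ ∘ₗ LinearMap.single K (fun _ => X) i

/-- The representation `Φ⁻ρ`. -/
def coxInv (ρ : LinRep K X) : LinRep K ((Fin 3 → X) ⧸ ρ.relSpace) :=
  ofChains (fun i => (ρ (y i)).map (ρ.incl i)) (fun i => LinearMap.range (ρ.incl i))
    fun _ => LinearMap.map_le_range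

theorem coxInv_x (ρ : LinRep K X) (i : Fin 3) : ρ.coxInv (x i) = (ρ (y i)).map (ρ.incl i) := rfl

theorem sum_incl (ρ : LinRep K X) (ξ : Fin 3 → X) :
    ρ.incl 0 (ξ 0) + ρ.incl 1 (ξ 1) + ρ.incl 2 (ξ 2) = ρ.relSpace.mkQ ξ := by
  simp only [incl, LinearMap.comp_apply, ← map_add]
  congr 1
  ext i
  fin_cases i <;> simp

theorem sum_incl_eq_zero (ρ : LinRep K X) {ξ : Fin 3 → X} :
    ρ.incl 0 (ξ 0) + ρ.incl 1 (ξ 1) + ρ.incl 2 (ξ 2) = 0 ↔ ∃ z, ∀ i, ξ i - z ∈ ρ (x i) := by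
  rw [sum_incl, Submodule.mkQ_apply, Submodule.Quotient.mk_eq_zero]
  rfl

theorem sum_incl_diag (ρ : LinRep K X) (z : X) : ρ.incl 0 z + ρ.incl 1 z + ρ.incl 2 z = 0 :=
  (ρ.sum_incl_eq_zero (ξ := fun _ => z)).2 ⟨z, fun i => by simp⟩

/-- Subtracting the diagonal vector of ξ_k removes the k-th coordinate without changing the class.
-/
theorem spanning_coxInv (ρ : LinRep K X) : ρ.coxInv.Spanning := by
  intro i j hij
  obtain ⟨k, h⟩ : ∃ k, Distinct i j k := by
    have : ∀ i j : Fin 3, i ≠ j → ∃ k, i ≠ j ∧ j ≠ k ∧ i ≠ k := by decide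
    obtain ⟨k, h₁, h₂, h₃⟩ := this i j hij
    exact ⟨k, h₁, h₂, h₃⟩
  rw [eq_top_iff]
  intro w _
  obtain ⟨ξ, rfl⟩ := Submodule.mkQ_surjective _ w
  rw [← sum_incl, ← h.sum_eq fun s => ρ.incl s (ξ s)]
  have e := ρ.sum_incl_diag (ξ k)
  rw [← h.sum_eq fun s => ρ.incl s (ξ k)] at e
  refine Submodule.mem_sup.2 ⟨_, ⟨ξ i - ξ k, rfl⟩, _, ⟨ξ j - ξ k, rfl⟩, ?_⟩
  rw [map_sub, map_sub, ← sub_eq_zero, ← neg_eq_zero, ← e]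
  abel

/-- If the vector with single coordinate z is diagonal modulo the X's, with diagonal value w, then w
lies in the intersection of the other two X's, which is zero. -/
theorem incl_eq_zero {ρ : LinRep K X} (hρ : ∀ i j, i ≠ j → ρ (x i) ⊓ ρ (x j) = ⊥) {i : Fin 3}
    {z : X} : ρ.incl i z = 0 ↔ z ∈ ρ (x i) := by
  have hd := distinct_add i
  have e : ρ.incl i z = ρ.relSpace.mkQ (Pi.single i z) := rfl
  rw [e, Submodule.mkQ_apply, Submodule.Quotient.mk_eq_zero]
  constructor
  · rintro ⟨w, hw⟩
    obtain ⟨h₁, h₂, h₃⟩ := hd.forall_iff.1 hw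
    rw [Pi.single_eq_same] at h₁
    rw [Pi.single_eq_of_ne hd.ij.symm, zero_sub] at h₂
    rw [Pi.single_eq_of_ne hd.ik.symm, zero_sub] at h₃
    have hw0 : w = 0 := by
      have : -w ∈ (⊥ : Submodule K X) := hρ _ _ hd.jk ▸ ⟨h₂, h₃⟩
      exact neg_eq_zero.1 ((Submodule.mem_bot K).1 this)
    rwa [hw0, sub_zero] at h₁
  · intro hz
    refine ⟨0, hd.forall_iff.2 ⟨?_, ?_, ?_⟩⟩
    · rwa [Pi.single_eq_same, sub_zero]
    · rw [Pi.single_eq_of_ne hd.ij.symm, sub_zero]; exact zero_mem _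
    · rw [Pi.single_eq_of_ne hd.ik.symm, sub_zero]; exact zero_mem _

/-- `Φ⁺Φ⁻ρ` is isomorphic to `ρ` if the subspaces `X_i` are disjoint. -/
theorem exists_equiv_cox_coxInv {ρ : LinRep K X}
    (hρ : ∀ i j, i ≠ j → ρ (x i) ⊓ ρ (x j) = ⊥) :
    ∃ f : X ≃ₗ[K] coxSpace ρ.coxInv, ∀ a, (ρ a).map (f : X →ₗ[K] coxSpace ρ.coxInv) =
      ρ.coxInv.cox a := by
  let g : X →ₗ[K] coxSpace ρ.coxInv :=
    LinearMap.codRestrict _ (LinearMap.pi ρ.incl) fun z => ⟨fun i => ⟨z, rfl⟩, ρ.sum_incl_diag z⟩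
  have hg (i : Fin 3) (z : X) : ρ.coxInv.proj i (g z) = ρ.incl i z := rfl
  have hinj : Function.Injective g := by
    rw [injective_iff_map_eq_zero]
    intro z hz
    have h (i : Fin 3) : z ∈ ρ (x i) := by
      rw [← incl_eq_zero hρ, ← hg, hz, map_zero]
    exact (Submodule.mem_bot K).1 (hρ 0 1 (by decide) ▸ ⟨h 0, h 1⟩)
  have hsurj : Function.Surjective g := by
    intro η
    have h (i : Fin 3) : ∃ z, ρ.incl i z = ρ.coxInv.proj i η := ρ.coxInv.proj_mem i η
    choose ξ hξ using h
    have hd : Distinct 0 1 2 := ⟨by decide, by decide, by decide⟩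
    -- The coordinates of η lift to some ξ_i, and the vanishing of their sum says that the ξ_i agree
    -- with a common z modulo the X_i.
    obtain ⟨z, hz⟩ := ρ.sum_incl_eq_zero.1 (by rw [hξ, hξ, hξ]; exact ρ.coxInv.proj_sum hd η)
    have key (i : Fin 3) : ρ.coxInv.proj i (g z) = ρ.coxInv.proj i η := by
      rw [hg, ← hξ, eq_comm, ← sub_eq_zero, ← map_sub, incl_eq_zero hρ]
      exact hz i
    exact ⟨z, ρ.coxInv.coxSpace_ext hd (key 0) (key 1)⟩
  let f := LinearEquiv.ofBijective g ⟨hinj, hsurj⟩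
  have hmap (P : Submodule K X) (Q : Submodule K (coxSpace ρ.coxInv))
      (h : ∀ z, z ∈ P ↔ g z ∈ Q) : P.map (f : X →ₗ[K] coxSpace ρ.coxInv) = Q := by
    ext η
    obtain ⟨z, rfl⟩ := hsurj η
    rw [← h]
    exact ⟨fun ⟨w, hw, he⟩ => hinj he ▸ hw, fun hz => ⟨z, hz, rfl⟩⟩
  refine ⟨f, map_equiv ρ _ f (fun i => hmap _ _ fun z => ?_) fun i => hmap _ _ fun z => ?_⟩
  · rw [cox_x, Submodule.mem_comap, Submodule.mem_bot, hg, incl_eq_zero hρ]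
  · rw [cox_y, Submodule.mem_comap, hg, coxInv_x]
    refine ⟨fun h => ⟨z, h, rfl⟩, fun ⟨w, hw, he⟩ => ?_⟩
    rw [← sub_eq_zero, ← map_sub, incl_eq_zero hρ] at he
    have := sub_mem hw (ρ.x_le_y i he)
    rwa [sub_sub_cancel] at this

/-! ### The defect -/

/-- The defect of a representation. -/
noncomputable def defect (ρ : LinRep K X) : ℤ :=
  ∑ i, ((Module.finrank K (ρ (x i)) : ℤ) + Module.finrank K (ρ (y i))) - 3 * Module.finrank K X

/-- Rank-nullity for the sum map from Y_1 × Y_2 × Y_3 to X, which is onto by spanning and has the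
space of Φ⁺ρ as kernel. -/
theorem finrank_coxSpace [FiniteDimensional K X] {ρ : LinRep K X} (hs : ρ.Spanning) :
    Module.finrank K (coxSpace ρ) + Module.finrank K X = ∑ i, Module.finrank K (ρ (y i)) := by
  let s : (∀ i, ρ (y i)) →ₗ[K] X := ∑ i, (ρ (y i)).subtype ∘ₗ LinearMap.proj i
  have hsa (f : ∀ i, ρ (y i)) : s f = f 0 + f 1 + f 2 := by
    simp [s, Fin.sum_univ_three]
  have hr : LinearMap.range s = ⊤ := by
    rw [eq_top_iff, ← hs 0 1 (by decide)]
    refine sup_le (fun z hz => ⟨Pi.single 0 ⟨z, hz⟩, ?_⟩) fun z hz => ⟨Pi.single 1 ⟨z, hz⟩, ?_⟩ <;>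
    simp [hsa]
  let e : LinearMap.ker s ≃ₗ[K] coxSpace ρ :=
    { toFun := fun f => ⟨fun i => f.1 i, fun i => (f.1 i).2, (hsa f.1).symm.trans f.2⟩
      map_add' := fun _ _ => rfl
      map_smul' := fun _ _ => rfl
      invFun := fun η => ⟨fun i => ⟨η.1 i, η.2.1 i⟩, (hsa _).trans η.2.2⟩
      left_inv := fun _ => rfl
      right_inv := fun _ => rfl }
  have := LinearMap.finrank_range_add_finrank_ker s
  rw [hr, finrank_top, e.finrank_eq, Module.finrank_pi_fintype] at this
  omega

theorem finrank_cox_x [FiniteDimensional K X] {ρ : LinRep K X} (hs : ρ.Spanning) (i : Fin 3) :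
    Module.finrank K (ρ.cox (x i)) + Module.finrank K (ρ (y i)) =
      Module.finrank K (coxSpace ρ) := by
  have h := LinearMap.finrank_range_add_finrank_ker (ρ.proj i)
  have hr : LinearMap.range (ρ.proj i) = ρ (y i) := by
    have e : (ρ (y i)).comap (ρ.proj i) = ⊤ := eq_top_iff.2 fun η _ => ρ.proj_mem i η
    rw [LinearMap.range_eq_map, ← e, hs.map_proj i le_rfl]
  rw [hr] at h
  rw [← h, add_comm]
  rfl

theorem finrank_cox_y [FiniteDimensional K X] {ρ : LinRep K X} (hs : ρ.Spanning) (i : Fin 3) :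
    Module.finrank K (ρ.cox (y i)) =
      Module.finrank K (ρ (x i)) + Module.finrank K (ρ.cox (x i)) := by
  have h := LinearMap.finrank_range_add_finrank_ker (K := K) (V := ρ.cox (y i))
    ((ρ.proj i).domRestrict (ρ.cox (y i)))
  have hr : LinearMap.range ((ρ.proj i).domRestrict (ρ.cox (y i))) = ρ (x i) := by
    rw [LinearMap.range_domRestrict, cox_y, hs.map_proj i (ρ.x_le_y i)]
  have hk : Module.finrank K (LinearMap.ker ((ρ.proj i).domRestrict (ρ.cox (y i)))) =
      Module.finrank K (ρ.cox (x i)) := by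
    rw [LinearMap.ker_domRestrict]
    exact (Submodule.comapSubtypeEquivOfLe (ρ.cox.x_le_y i)).finrank_eq
  rw [hr, hk] at h
  exact h.symm

/-- With a plus for Φ⁺ρ, substitute dim X⁺ = ∑ dim Y_i - dim X, dim X_i⁺ = dim X⁺ - dim Y_i and dim
Y_i⁺ = dim X_i + dim X_i⁺. -/
theorem defect_cox [FiniteDimensional K X] {ρ : LinRep K X} (hs : ρ.Spanning) :
    ρ.cox.defect = ρ.defect := by
  have h := finrank_coxSpace hs
  have hx := finrank_cox_x hs
  have hy := finrank_cox_y hs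
  simp only [defect, Fin.sum_univ_three] at h ⊢
  have := hx 0
  have := hx 1
  have := hx 2
  have := hy 0
  have := hy 1
  have := hy 2
  omega

theorem defect_of_equiv {X' : Type u} [AddCommGroup X'] [Module K X'] {ρ : LinRep K X}
    {ρ' : LinRep K X'} (f : X ≃ₗ[K] X') (hf : ∀ a, (ρ a).map (f : X →ₗ[K] X') = ρ' a) :
    ρ'.defect = ρ.defect := by
  have h (a : D222) : Module.finrank K (ρ' a) = Module.finrank K (ρ a) := by
    rw [← hf]
    exact f.finrank_map_eq _
  simp only [defect, h, f.finrank_eq]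

/-- A nonzero vector common to X_j and X_k, together with the kernel of a functional adapted to X_i
⊆ Y_i, gives a compatible decomposition, so X is a line. Then X_j, Y_j, X_k, Y_k are all of X and
the defect is at least 4 - 3 > 0. -/
theorem Indecomposable.inf_eq_bot [FiniteDimensional K X] {ρ : LinRep K X}
    (hρ : ρ.Indecomposable) (hdef : ρ.defect < 0) (j k : Fin 3) (hjk : j ≠ k) :
    ρ (x j) ⊓ ρ (x k) = ⊥ := by
  by_contra hne
  obtain ⟨v, ⟨hj, hk⟩, hv0⟩ := Submodule.exists_mem_ne_zero_of_ne_bot hne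
  obtain ⟨i, h⟩ : ∃ i, Distinct j k i := by
    have : ∀ j k : Fin 3, j ≠ k → ∃ i, j ≠ k ∧ k ≠ i ∧ j ≠ i := by decide
    obtain ⟨i, h₁, h₂, h₃⟩ := this j k hjk
    exact ⟨i, h₁, h₂, h₃⟩
  have hex (W : Submodule K X) (hW : v ∉ W) : ∃ f : X →ₗ[K] K, f v ≠ 0 ∧ W ≤ LinearMap.ker f := by
    obtain ⟨f, hf, hf'⟩ := Submodule.exists_le_ker_of_notMem hW
    exact ⟨f, hf, hf'⟩
  obtain ⟨f, hf, hx, hy⟩ : ∃ f : X →ₗ[K] K, f v ≠ 0 ∧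
      (v ∈ ρ (x i) ∨ ρ (x i) ≤ LinearMap.ker f) ∧ (v ∈ ρ (y i) ∨ ρ (y i) ≤ LinearMap.ker f) := by
    by_cases hy : v ∈ ρ (y i)
    · by_cases hx : v ∈ ρ (x i)
      · obtain ⟨f, hf, -⟩ := hex ⊥ (by simpa using hv0)
        exact ⟨f, hf, .inl hx, .inl hy⟩
      · obtain ⟨f, hf, hf'⟩ := hex _ hx
        exact ⟨f, hf, .inr hf', .inl hy⟩
    · obtain ⟨f, hf, hf'⟩ := hex _ hy
      exact ⟨f, hf, .inr ((ρ.x_le_y i).trans hf'), .inr hf'⟩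
  have hker := hρ.ker_eq_bot f hf (h.forall_iff.2 ⟨.inl hj, .inl hk, hx⟩)
    (h.forall_iff.2 ⟨.inl (ρ.x_le_y j hj), .inl (ρ.x_le_y k hk), hy⟩)
  have htop (W : Submodule K X) (hW : v ∈ W) : Module.finrank K W = Module.finrank K X := by
    rw [(eq_bot_or_eq_top_of_ker_eq_bot hker W).resolve_left, finrank_top]
    rintro rfl
    exact hv0 ((Submodule.mem_bot K).1 hW)
  have e := h.sum_eq fun s => (Module.finrank K (ρ (x s)) : ℤ) + Module.finrank K (ρ (y s))
  rw [defect, Fin.sum_univ_three, ← e, htop _ hj, htop _ hk, htop _ (ρ.x_le_y j hj),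
    htop _ (ρ.x_le_y k hk)] at hdef
  omega

end LinRep

open LinRep

/-! ## Existence of indecomposable representations of each type -/

section

variable {K : Type u} [Field K] {X : Type u} [AddCommGroup X] [Module K X]

theorem HasType.of_equiv {X' : Type u} [AddCommGroup X'] [Module K X'] {ρ : LinRep K X}
    {ρ' : LinRep K X'} (f : X ≃ₗ[K] X') (hf : ∀ a, (ρ a).map (f : X →ₗ[K] X') = ρ' a)
    {n : ℕ} {τ : Option (Option (Fin 4))} (h : HasType ρ n τ) : HasType ρ' n τ := by
  have hbot {a : D222} (ha : ρ a = ⊥) : ρ' a = ⊥ := by rw [← hf, ha, Submodule.map_bot]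
  have htop {a : D222} (ha : ρ a = ⊤) : ρ' a = ⊤ := by
    rw [← hf, ha, Submodule.map_top, LinearEquiv.range]
  have hite {a : D222} {p : Prop} [Decidable p] (ha : ρ a = if p then ⊥ else ⊤) :
      ρ' a = if p then ⊥ else ⊤ := by
    split_ifs at ha ⊢
    exacts [hbot ha, htop ha]
  cases h with
  | zero i hb hc => exact .zero i (hbot hb) fun j => hbot (hc j)
  | full ha hb hc => exact .full (fun j => htop (ha j)) (fun j => htop (hb j)) fun j => htop (hc j)
  | arm i ha hb hc =>
    exact .arm i (fun j => hite (ha j)) (fun j => htop (hb j)) fun j => hite (hc j)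
  | center ha hb hc =>
    exact .center (fun j => htop (ha j)) (fun j => htop (hb j)) fun j => hbot (hc j)

/-- Every finite-dimensional indecomposable representation with negative defect is isomorphic to
`Φ⁺ρ` for such a representation `ρ`. -/
theorem exists_cox_equiv [FiniteDimensional K X] {ρ : LinRep K X} (hρ : ρ.Indecomposable)
    (hdef : ρ.defect < 0) : ∃ (X' : Type u) (_ : AddCommGroup X') (_ : Module K X')
      (σ : LinRep K X'), FiniteDimensional K X' ∧ σ.Indecomposable ∧ σ.defect < 0 ∧ σ.Spanning ∧
        ∃ f : X ≃ₗ[K] coxSpace σ, ∀ a, (ρ a).map (f : X →ₗ[K] coxSpace σ) = σ.cox a := by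
  obtain ⟨f, hf⟩ := exists_equiv_cox_coxInv (hρ.inf_eq_bot hdef)
  have hs := ρ.spanning_coxInv
  refine ⟨_, inferInstance, inferInstance, ρ.coxInv, inferInstance,
    indecomposable_of_cox hs (hρ.of_equiv f hf), ?_, hs, f, hf⟩
  rwa [← defect_cox hs, defect_of_equiv f hf]

/-- Replacing ρ by some σ with Φ⁺σ ≅ ρ raises the level by one; negativity of the defect survives,
so the step can be repeated. -/
theorem exists_hasType_of_zero {τ : Option (Option (Fin 4))}
    (h : ∃ (X : Type u) (_ : AddCommGroup X) (_ : Module K X) (ρ : LinRep K X),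
      FiniteDimensional K X ∧ ρ.Indecomposable ∧ ρ.defect < 0 ∧ HasType ρ 0 τ) (n : ℕ) :
    ∃ (X : Type u) (_ : AddCommGroup X) (_ : Module K X) (ρ : LinRep K X),
      FiniteDimensional K X ∧ ρ.Indecomposable ∧ ρ.defect < 0 ∧ HasType ρ n τ := by
  induction n with
  | zero => exact h
  | succ n ih =>
    obtain ⟨X, _, _, ρ, _, hρ, hdef, hτ⟩ := ih
    obtain ⟨X', i₁, i₂, σ, hfd, hσ, hdef', hs, f, hf⟩ := exists_cox_equiv hρ hdef
    exact ⟨X', i₁, i₂, σ, hfd, hσ, hdef', (hτ.of_equiv f hf).succ hs⟩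

theorem indecomposable_of_line (ρ : LinRep K K) : ρ.Indecomposable :=
  indecomposable_of_splits fun U V hUV _ _ => (eq_bot_or_eq_top U).imp_right fun hU => by
    have := hUV.inf_eq_bot
    rwa [hU, top_inf_eq] at this

theorem exists_hasType (K : Type u) [Field K] (n : ℕ) (m : Fin 4) :
    ∃ (X : Type u) (_ : AddCommGroup X) (_ : Module K X) (ρ : LinRep K X),
      FiniteDimensional K X ∧ ρ.Indecomposable ∧ HasType ρ n (some (some m)) := by
  suffices h : ∃ (X : Type u) (_ : AddCommGroup X) (_ : Module K X) (ρ : LinRep K X),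
      FiniteDimensional K X ∧ ρ.Indecomposable ∧ ρ.defect < 0 ∧ HasType ρ 0 (some (some m)) by
    obtain ⟨X, i₁, i₂, ρ, h₁, h₂, -, h₃⟩ := exists_hasType_of_zero h n
    exact ⟨X, i₁, i₂, ρ, h₁, h₂, h₃⟩
  refine Fin.lastCases ?_ (fun i => ?_) m
  -- Central type: the line with all six subspaces zero has defect -3. It is not of this type
  -- itself, but a spanning σ with Φ⁺σ isomorphic to it is.
  · let ρ : LinRep K K := ofChains (fun _ => ⊥) (fun _ => ⊥) fun _ => le_rfl
    have h0 (i : Fin 3) : Module.finrank K (ρ (x i)) = 0 ∧ Module.finrank K (ρ (y i)) = 0 :=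
      ⟨finrank_bot K K, finrank_bot K K⟩
    have hdef : ρ.defect < 0 := by
      simp [defect, h0]
    obtain ⟨X, i₁, i₂, σ, hfd, hσ, hdef', hs, f, hf⟩ :=
      exists_cox_equiv (indecomposable_of_line ρ) hdef
    refine ⟨X, i₁, i₂, σ, hfd, hσ, hdef', ?_⟩
    have hc := hσ.cox hs
    have := hc.1
    have hne : σ.cox (y 0 ⊔ y 1 ⊔ y 2) ≠ ⊤ := by
      rw [← hf, map_sup, map_sup]
      simp only [ρ, ofChains_y, sup_bot_eq, Submodule.map_bot]
      exact bot_ne_top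
    have := hasType_zero_of_spanning hs hc
    rwa [if_neg hne] at this
  -- Arm i: the line with X_i = Y_i = K and the other subspaces zero, of defect 2 - 3 = -1.
  · let P (j : Fin 3) : Submodule K K := if j = i then ⊤ else ⊥
    let ρ : LinRep K K := ofChains P P fun _ => le_rfl
    have hP : P i = ⊤ := if_pos rfl
    have hP' (j : Fin 3) (hj : j ≠ i) : P j = ⊥ := if_neg hj
    refine ⟨K, inferInstance, inferInstance, ρ, inferInstance, indecomposable_of_line ρ, ?_, ?_⟩
    · have hd := distinct_add i
      have e := hd.sum_eq fun s => (Module.finrank K (ρ (x s)) : ℤ) + Module.finrank K (ρ (y s))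
      have h1 : Module.finrank K (P i) = 1 := by rw [hP, finrank_top, Module.finrank_self]
      have h0 (j : Fin 3) (hj : j ≠ i) : Module.finrank K (P j) = 0 := by
        rw [hP' j hj, finrank_bot]
      have hx : Module.finrank K (ρ (x i)) = 1 := h1
      have hy : Module.finrank K (ρ (y i)) = 1 := h1
      have hx' (j : Fin 3) (hj : j ≠ i) : Module.finrank K (ρ (x j)) = 0 := h0 j hj
      have hy' (j : Fin 3) (hj : j ≠ i) : Module.finrank K (ρ (y j)) = 0 := h0 j hj
      rw [defect, Fin.sum_univ_three, ← e, hx, hy, hx' _ hd.ij.symm, hx' _ hd.ik.symm,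
        hy' _ hd.ij.symm, hy' _ hd.ik.symm, Module.finrank_self]
      norm_num
    · have := hasType_of_simple (ρ := ρ) hP' (.inr hP) 0
      rwa [if_pos ⟨rfl, hP⟩] at this

end

/-! ## The two cubes -/

/-- The elements of the two cubes `U_n` and `V_{n+1}`, indexed by a Boolean algebra. -/
def cubeElt (n : ℕ) : Bool × Bool × Bool × Bool → D222
  | (true, true, true, true) => bGen 0 n ⊓ bGen 1 n ⊓ bGen 2 n
  | (false, true, true, true) => aGen 0 n ⊓ bGen 1 n ⊓ bGen 2 n
  | (true, false, true, true) => bGen 0 n ⊓ aGen 1 n ⊓ bGen 2 n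
  | (true, true, false, true) => bGen 0 n ⊓ bGen 1 n ⊓ aGen 2 n
  | (false, false, true, true) => aGen 0 n ⊓ aGen 1 n ⊓ bGen 2 n
  | (false, true, false, true) => aGen 0 n ⊓ bGen 1 n ⊓ aGen 2 n
  | (true, false, false, true) => bGen 0 n ⊓ aGen 1 n ⊓ aGen 2 n
  | (false, false, false, true) => aGen 0 n ⊓ aGen 1 n ⊓ aGen 2 n
  | (false, true, true, false) => cGen 0 (n + 1)
  | (true, false, true, false) => cGen 1 (n + 1)
  | (true, true, false, false) => cGen 2 (n + 1)
  | (false, false, true, false) => cGen 0 (n + 1) ⊓ cGen 1 (n + 1)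
  | (true, false, false, false) => cGen 1 (n + 1) ⊓ cGen 2 (n + 1)
  | (false, true, false, false) => cGen 0 (n + 1) ⊓ cGen 2 (n + 1)
  | (false, false, false, false) => cGen 0 (n + 1) ⊓ cGen 1 (n + 1) ⊓ cGen 2 (n + 1)
  | (true, true, true, false) => cGen 0 (n + 1) ⊔ cGen 1 (n + 1) ⊔ cGen 2 (n + 1)

theorem lowerCube_eq (n : ℕ) : lowerCube n = cubeElt n '' {s | s.2.2.2 = true} := by
  ext d
  constructor
  · rintro (rfl | rfl | rfl | rfl | rfl | rfl | rfl | rfl)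
    exacts [⟨(true, true, true, true), rfl, rfl⟩, ⟨(false, true, true, true), rfl, rfl⟩,
      ⟨(true, false, true, true), rfl, rfl⟩, ⟨(true, true, false, true), rfl, rfl⟩,
      ⟨(false, false, true, true), rfl, rfl⟩, ⟨(false, true, false, true), rfl, rfl⟩,
      ⟨(true, false, false, true), rfl, rfl⟩, ⟨(false, false, false, true), rfl, rfl⟩]
  · rintro ⟨⟨p, q, r, s⟩, hs, rfl⟩
    obtain rfl : s = true := hs
    cases p <;> cases q <;> cases r <;> simp [cubeElt, lowerCube]

theorem upperCube_eq (n : ℕ) : upperCube (n + 1) = cubeElt n '' {s | s.2.2.2 = false} := by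
  ext d
  constructor
  · rintro (rfl | rfl | rfl | rfl | rfl | rfl | rfl | rfl)
    exacts [⟨(false, true, true, false), rfl, rfl⟩, ⟨(true, false, true, false), rfl, rfl⟩,
      ⟨(true, true, false, false), rfl, rfl⟩, ⟨(false, false, true, false), rfl, rfl⟩,
      ⟨(true, false, false, false), rfl, rfl⟩, ⟨(false, true, false, false), rfl, rfl⟩,
      ⟨(false, false, false, false), rfl, rfl⟩, ⟨(true, true, true, false), rfl, rfl⟩]
  · rintro ⟨⟨p, q, r, s⟩, hs, rfl⟩
    obtain rfl : s = false := hs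
    cases p <;> cases q <;> cases r <;> simp [cubeElt, upperCube]

/-- The value (zero or the whole space) of an element of the cubes in a representation of a given
type. -/
def cubeValue : Option (Option (Fin 4)) → Bool × Bool × Bool × Bool → Bool
  | none, _ => false
  | some none, _ => true
  | some (some m), (p, q, r, s) => ![p, q, r, s] m

theorem cubeValue_sup (τ : Option (Option (Fin 4))) (s t : Bool × Bool × Bool × Bool) :
    cubeValue τ (s ⊔ t) = (cubeValue τ s || cubeValue τ t) := by
  rcases τ with _ | _ | m
  · rfl
  · rfl
  · fin_cases m <;> rfl

theorem cubeValue_inf (τ : Option (Option (Fin 4))) (s t : Bool × Bool × Bool × Bool) :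
    cubeValue τ (s ⊓ t) = (cubeValue τ s && cubeValue τ t) := by
  rcases τ with _ | _ | m
  · rfl
  · rfl
  · fin_cases m <;> rfl

section

variable {K : Type u} [Field K] {X : Type u} [AddCommGroup X] [Module K X]

/-- Arm i annihilates exactly the elements whose i-th coordinate is `false`, and the central type
exactly those of the upper cube, so these types read off the coordinates. -/
theorem HasType.apply_cubeElt {ρ : LinRep K X} {n : ℕ} {τ : Option (Option (Fin 4))}
    (h : HasType ρ n τ) (s : Bool × Bool × Bool × Bool) :
    ρ (cubeElt n s) = if cubeValue τ s then ⊤ else ⊥ := by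
  obtain ⟨p, q, r, s⟩ := s
  cases h with
  | zero i hb hc =>
    have ha : ρ (aGen i n) = ⊥ := eq_bot_iff.2 (hb ▸ ρ.mono (aGen_le_bGen i n))
    fin_cases i <;> simp only [Fin.zero_eta, Fin.mk_one, Fin.reduceFinMk] at ha hb <;>
    cases p <;> cases q <;> cases r <;> cases s <;> simp [cubeElt, cubeValue, ha, hb, hc]
  | full ha hb hc =>
    cases p <;> cases q <;> cases r <;> cases s <;> simp [cubeElt, cubeValue, ha, hb, hc]
  | arm i ha hb hc =>
    fin_cases i <;>
    cases p <;> cases q <;> cases r <;> cases s <;> simp [cubeElt, cubeValue, ha, hb, hc]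
  | center ha hb hc =>
    cases p <;> cases q <;> cases r <;> cases s <;> simp [cubeElt, cubeValue, ha, hb, hc]

end

end D222

/-! ### The two cubes in the quotient lattice -/

namespace D222ModTheta

open D222

variable {K : Type u} [Field K]

theorem mk_eq {a b : D222} (h : ∀ (X : Type u) [AddCommGroup X] [Module K X] (ρ : LinRep K X),
    ρ.Indecomposable → ρ a = ρ b) : mk K a = mk K b :=
  Quotient.sound fun X _ _ _ ρ hρ => h X ρ hρ

theorem mk_le {a b : D222} (h : ∀ (X : Type u) [AddCommGroup X] [Module K X] (ρ : LinRep K X),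
    ρ.Indecomposable → ρ a ≤ ρ b) : mk K a ≤ mk K b := by
  refine sup_eq_right.1 ((mk_sup a b).trans (mk_eq fun X _ _ ρ hρ => ?_))
  rw [map_sup, sup_eq_right.2 (h X ρ hρ)]

theorem mk_cubeElt_sup (n : ℕ) (s t : Bool × Bool × Bool × Bool) :
    mk K (cubeElt n (s ⊔ t)) = mk K (cubeElt n s) ⊔ mk K (cubeElt n t) := by
  rw [mk_sup]
  refine mk_eq fun X _ _ ρ hρ => ?_
  obtain ⟨τ, h⟩ := hρ.hasType n
  rw [map_sup, h.apply_cubeElt, h.apply_cubeElt, h.apply_cubeElt, cubeValue_sup]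
  cases cubeValue τ s <;> cases cubeValue τ t <;> simp

theorem mk_cubeElt_inf (n : ℕ) (s t : Bool × Bool × Bool × Bool) :
    mk K (cubeElt n (s ⊓ t)) = mk K (cubeElt n s) ⊓ mk K (cubeElt n t) := by
  rw [mk_inf]
  refine mk_eq fun X _ _ ρ hρ => ?_
  obtain ⟨τ, h⟩ := hρ.hasType n
  rw [map_inf, h.apply_cubeElt, h.apply_cubeElt, h.apply_cubeElt, cubeValue_inf]
  cases cubeValue τ s <;> cases cubeValue τ t <;> simp

/-- Each coordinate is detected by a finite-dimensional indecomposable of the matching type, in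
which `⊥` and `⊤` differ because the space is nonzero. -/
theorem mk_cubeElt_injective (n : ℕ) : Function.Injective fun s => mk K (cubeElt n s) := by
  intro s t hst
  have hst' := Quotient.exact hst
  have key (m : Fin 4) : cubeValue (some (some m)) s = cubeValue (some (some m)) t := by
    obtain ⟨X, _, _, ρ, _, hρ, h⟩ := exists_hasType K n m
    have := hρ.1
    have e := hst' X ρ hρ
    rw [h.apply_cubeElt, h.apply_cubeElt] at e
    cases h₁ : cubeValue (some (some m)) s <;> cases h₂ : cubeValue (some (some m)) t <;>
      simp_all
  obtain ⟨p, q, r, s⟩ := s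
  obtain ⟨p', q', r', s'⟩ := t
  have e₀ : p = p' := key 0
  have e₁ : q = q' := key 1
  have e₂ : r = r' := key 2
  have e₃ : s = s' := key 3
  rw [e₀, e₁, e₂, e₃]

end D222ModTheta

/-! ### Boolean sublattices, their images, and the final assembly -/

theorem IsBooleanSublattice.image {B L : Type*} [Lattice B] [Lattice L] {f : B → L}
    (hsup : ∀ s t, f (s ⊔ t) = f s ⊔ f t) (hinf : ∀ s t, f (s ⊓ t) = f s ⊓ f t) {T : Set B}
    (hT : IsBooleanSublattice T) : IsBooleanSublattice (f '' T) where
  supClosed := by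
    rintro _ ⟨s, hs, rfl⟩ _ ⟨t, ht, rfl⟩
    exact ⟨s ⊔ t, hT.supClosed hs ht, hsup s t⟩
  infClosed := by
    rintro _ ⟨s, hs, rfl⟩ _ ⟨t, ht, rfl⟩
    exact ⟨s ⊓ t, hT.infClosed hs ht, hinf s t⟩
  distrib := by
    rintro _ ⟨r, hr, rfl⟩ _ ⟨s, hs, rfl⟩ _ ⟨t, ht, rfl⟩
    rw [← hsup, ← hinf, hT.distrib r hr s hs t ht, hsup, hinf, hinf]
  complemented := by
    obtain ⟨o, ho, e, he, hoe, hc⟩ := hT.complemented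
    have hmono {s t : B} (h : s ≤ t) : f s ≤ f t := by
      rw [← sup_eq_right, ← hsup, sup_eq_right.2 h]
    refine ⟨f o, ⟨o, ho, rfl⟩, f e, ⟨e, he, rfl⟩, ?_, ?_⟩
    · rintro _ ⟨z, hz, rfl⟩
      exact ⟨hmono (hoe z hz).1, hmono (hoe z hz).2⟩
    · rintro _ ⟨z, hz, rfl⟩
      obtain ⟨z', hz', h₁, h₂⟩ := hc z hz
      exact ⟨f z', ⟨z', hz', rfl⟩, by rw [← hinf, h₁], by rw [← hsup, h₂]⟩

theorem isBooleanSublattice_univ {B : Type*} [BooleanAlgebra B] :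
    IsBooleanSublattice (Set.univ : Set B) where
  supClosed := supClosed_univ
  infClosed := infClosed_univ
  distrib a _ b _ c _ := inf_sup_left a b c
  complemented := ⟨⊥, trivial, ⊤, trivial, fun _ _ => ⟨bot_le, le_top⟩, fun z _ =>
    ⟨zᶜ, trivial, inf_compl_eq_bot, sup_compl_eq_top⟩⟩

theorem isBooleanSublattice_last (c : Bool) :
    IsBooleanSublattice {s : Bool × Bool × Bool × Bool | s.2.2.2 = c} where
  supClosed := by
    rintro ⟨_, _, _, _⟩ rfl ⟨_, _, _, _⟩ h
    exact (congrArg₂ (· ⊔ ·) rfl h).trans (sup_idem _)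
  infClosed := by
    rintro ⟨_, _, _, _⟩ rfl ⟨_, _, _, _⟩ h
    exact (congrArg₂ (· ⊓ ·) rfl h).trans (inf_idem _)
  distrib a _ b _ d _ := inf_sup_left a b d
  complemented := by
    refine ⟨(false, false, false, c), rfl, (true, true, true, c), rfl, ?_, ?_⟩
    · rintro ⟨_, _, _, _⟩ rfl
      exact ⟨⟨Bool.false_le _, Bool.false_le _, Bool.false_le _, le_rfl⟩,
        Bool.le_true _, Bool.le_true _, Bool.le_true _, le_rfl⟩
    · rintro ⟨p, q, r, _⟩ rfl
      refine ⟨(!p, !q, !r, _), rfl, ?_, ?_⟩ <;> simp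

theorem mainTheorem7 (K : Type u) [Field K] (n : ℕ) :
    -- the two cubes are eight-element Boolean algebras modulo `θ`
    (IsBooleanSublattice (D222ModTheta.mk K '' D222.lowerCube n) ∧
      (D222ModTheta.mk K '' D222.lowerCube n).ncard = 8) ∧
    (IsBooleanSublattice (D222ModTheta.mk K '' D222.upperCube (n + 1)) ∧
      (D222ModTheta.mk K '' D222.upperCube (n + 1)).ncard = 8) ∧
    -- their union is a sixteen-element Boolean algebra modulo `θ`
    (IsBooleanSublattice (D222ModTheta.mk K '' (D222.lowerCube n ∪ D222.upperCube (n + 1))) ∧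
      (D222ModTheta.mk K '' (D222.lowerCube n ∪ D222.upperCube (n + 1))).ncard = 16) ∧
    -- the eight connecting inclusions modulo `θ`
    (∀ i j k : Fin 3, i ≠ j → i ≠ k → j ≠ k →
      D222ModTheta.mk K (D222.cGen i (n + 1)) ≤
        D222ModTheta.mk K (D222.aGen i n ⊓ D222.bGen j n ⊓ D222.bGen k n)) ∧
    (∀ i j k : Fin 3, i ≠ j → i ≠ k → j ≠ k →
      D222ModTheta.mk K (D222.cGen i (n + 1) ⊓ D222.cGen j (n + 1)) ≤
        D222ModTheta.mk K (D222.aGen i n ⊓ D222.aGen j n ⊓ D222.bGen k n)) ∧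
    D222ModTheta.mk K (D222.cGen 0 (n + 1) ⊓ D222.cGen 1 (n + 1) ⊓ D222.cGen 2 (n + 1)) ≤
      D222ModTheta.mk K (D222.aGen 0 n ⊓ D222.aGen 1 n ⊓ D222.aGen 2 n) ∧
    D222ModTheta.mk K (D222.cGen 0 (n + 1) ⊔ D222.cGen 1 (n + 1) ⊔ D222.cGen 2 (n + 1)) ≤
      D222ModTheta.mk K (D222.bGen 0 n ⊓ D222.bGen 1 n ⊓ D222.bGen 2 n) := by
  open D222 D222ModTheta in
  have hsup := mk_cubeElt_sup (K := K) n
  have hinf := mk_cubeElt_inf (K := K) n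
  have hinj := mk_cubeElt_injective (K := K) n
  have hB {T : Set (Bool × Bool × Bool × Bool)} (hT : IsBooleanSublattice T) (N : ℕ)
      (hN : T.ncard = N) : IsBooleanSublattice (mk K '' (cubeElt n '' T)) ∧
        (mk K '' (cubeElt n '' T)).ncard = N := by
    rw [Set.image_image]
    exact ⟨hT.image hsup hinf, (Set.ncard_image_of_injective T hinj).trans hN⟩
  have hcard (c : Bool) : {s : Bool × Bool × Bool × Bool | s.2.2.2 = c}.ncard = 8 := by
    rw [Set.ncard_eq_toFinset_card']
    cases c <;> decide
  have hunion : lowerCube n ∪ upperCube (n + 1) = cubeElt n '' Set.univ := by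
    rw [lowerCube_eq, upperCube_eq, ← Set.image_union]
    congr 1
    ext ⟨_, _, _, s⟩
    cases s <;> simp
  have hle {a b : D222} (h : ∀ (X : Type u) [AddCommGroup X] [Module K X] (ρ : LinRep K X) τ,
      HasType ρ n τ → ρ a ≤ ρ b) : mk K a ≤ mk K b := mk_le fun X _ _ ρ hρ => by
    obtain ⟨τ, hτ⟩ := hρ.hasType n
    exact h X ρ τ hτ
  refine ⟨?_, ?_, ?_, fun i j k _ _ _ => hle fun X _ _ ρ τ h => ?_,
    fun i j k _ _ _ => hle fun X _ _ ρ τ h => ?_, hle fun X _ _ ρ τ h => ?_,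
    hle fun X _ _ ρ τ h => ?_⟩
  · rw [lowerCube_eq]
    exact hB (isBooleanSublattice_last true) 8 (hcard true)
  · rw [upperCube_eq]
    exact hB (isBooleanSublattice_last false) 8 (hcard false)
  · rw [hunion]
    exact hB isBooleanSublattice_univ 16 (by rw [Set.ncard_univ, Nat.card_eq_fintype_card]; rfl)
  · cases h <;> simp [*]
  · cases h <;> simp [*]
  · cases h <;> simp [*]
  · cases h <;> simp [*]
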